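/- \textbf{Setting.} Let a finite connected graph be embedded in the torus so that all faces are disks (for instance, a square lattice with periodic boundary conditions), and put a qubit on every edge. The toric code Hamiltonian on $(\mathbb C^2)^{\otimes\{\text{edges}\}}$ is $$H=-U\sum_s A_s-J\sum_p B_p,\qquad U,J>0,\qquad A_s=\prod_{i\in \mathrm{legs}(s)}\sigma^x_i,\quad B_p=\prod_{i\in\partial p}\sigma^z_i,$$ with $s$ ranging over the vertices and $p$ over the faces. Divide the edges into four regions $A_1,A_2,B_1,B_2$ such that each star $A_s$ and each plaquette $B_p$ acts on at most two regions, no star or plaquette acts on both $A_1$ and $B_1$ (these two regions share no border), and every region is non-contractible, i.e. a non-contractible closed loop of the lattice or of the dual lattice runs inside it. For a closed loop $z$ of the lattice put $W^z=\prod_{i\in z}\sigma^z_i$, and for a closed loop $x$ of the dual lattice put $W^x=\prod_{i\in x}\sigma^x_i$ (product over the crossed edges). Let $z_1,x_1$ be non-contractible loops in one direction of the torus and $z_2,x_2$ in the other one (loops $z_a$ and $x_b$ cross an odd number of times if $a\ne b$ and an even number of times if $a=b$), with operators $W^z_1,W^x_1,W^z_2,W^x_2$. The states of definite flux are $$|\psi_I\rangle=N\prod_p\frac{1+B_p}{2}\,\frac{1+W^z_1}{2}\,|{+\cdots+}\rangle,\quad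 |\psi_e\rangle=W^x_2|\psi_I\rangle,\quad |\psi_m\rangle=W^z_2|\psi_I\rangle,\quad |\psi_{em}\rangle=W^x_2W^z_2|\psi_I\rangle ,$$ where $N>0$ normalizes $|\psi_I\rangle$. \textbf{Proposition.} Let $|\psi\rangle$ be any normalized ground state of $H$, and let $\rho_{A_1B_1}=\mathrm{tr}_{A_2B_2}|\psi\rangle\langle\psi|$. There are loops as above for which direction $1$ runs along $A_1$ (that is, $z_1$ or $x_1$ is, up to contractible loops, a loop inside $A_1$). For every choice of loops as above for which direction $1$ runs along $A_1$ or along $B_1$, there are complex numbers $c_i$, $i\in\{I,e,m,em\}$, with $\sum_i|c_i|^2=1$, $|\psi\rangle=\sum_i c_i|\psi_i\rangle$ and $$\rho_{A_1B_1}=\sum_{i\in\{I,e,m,em\}}|c_i|^2\,\rho^{(i)}_{A_1}\otimes\rho^{(i)}_{B_1},$$ where $\rho^{(i)}_{A_1}$ and $\rho^{(i)}_{B_1}$ are the reduced density matrices of $|\psi_i\rangle\langle\psi_i|$ on $A_1$ and $B_1$. In particular $\rho_{A_1B_1}$ is separable, i.e. a finite convex combination of product states, and its logarithmic negativity vanishes: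 $$E_{\mathcal N}^{A_1|B_1}(\rho_{A_1B_1})=\log_2\mathrm{tr}\left|\rho_{A_1B_1}^{T_{A_1}}\right|=0 .$$ -/

import Mathlib

open scoped Matrix Kronecker ComplexOrder MatrixOrder Matrix.Norms.L2Operator Classical

noncomputable section

/-! ## Qubits and Pauli operators

The space `(ℂ²)^{⊗ ι}` of a finite set `ι` of qubits is the space of functions `Config ι → ℂ`
(amplitudes in the computational basis); operators are matrices indexed by `Config ι`. -/

/-- Computational basis labels of the qubits `ι`. -/
abbrev Config (ι : Type*) := ι → ZMod 2

section Pauli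

variable {ι : Type*} [Fintype ι]

/-- `∏ σˣ_i` over the qubits `i` with `c i = 1`: it flips exactly these qubits. -/
def pauliX (c : ι → ZMod 2) : Matrix (Config ι) (Config ι) ℂ :=
  Matrix.of fun s t => if s = t + c then 1 else 0

/-- `∏ σᶻ_i` over the qubits `i` with `c i = 1`: the sign `(-1)^{∑ c_i s_i}`. -/
def pauliZ (c : ι → ZMod 2) : Matrix (Config ι) (Config ι) ℂ :=
  Matrix.diagonal fun s => if c ⬝ᵥ s = 0 then 1 else -1

/-- The Pauli operator `σˣ` on the qubit `i`. -/
def sigmaX (i : ι) : Matrix (Config ι) (Config ι) ℂ := pauliX (Pi.single i 1)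

/-- The Pauli operator `σᶻ` on the qubit `i`. -/
def sigmaZ (i : ι) : Matrix (Config ι) (Config ι) ℂ := pauliZ (Pi.single i 1)

theorem pauliX_zero : pauliX (0 : ι → ZMod 2) = 1 := by
  ext s t
  simp [pauliX, Matrix.one_apply]

theorem pauliZ_zero : pauliZ (0 : ι → ZMod 2) = 1 := by
  ext s t
  simp [pauliZ]

theorem pauliX_add (c d : ι → ZMod 2) : pauliX (c + d) = pauliX c * pauliX d := by
  ext s t
  simp only [pauliX, Matrix.mul_apply, Matrix.of_apply, mul_ite, mul_one, mul_zero]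
  rw [Finset.sum_eq_single (t + d)]
  · simp [add_assoc, add_comm d c]
  · intro b _ hb
    simp [hb]
  · simp

theorem pauliZ_add (c d : ι → ZMod 2) : pauliZ (c + d) = pauliZ c * pauliZ d := by
  have key : ∀ a b : ZMod 2, (if a + b = 0 then (1 : ℂ) else -1)
      = (if a = 0 then (1 : ℂ) else -1) * (if b = 0 then (1 : ℂ) else -1) := by
    intro a b
    have h2 : (1 + 1 : ZMod 2) = 0 := rfl
    have cases2 : ∀ t : ZMod 2, t = 0 ∨ t = 1 := by decide
    rcases cases2 a with rfl | rfl <;> rcases cases2 b with rfl | rfl <;> simp [h2]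
  simp only [pauliZ, Matrix.diagonal_mul_diagonal, add_dotProduct]
  congr 1
  funext s
  exact key _ _

theorem pauliZ_commute (c d : ι → ZMod 2) : Commute (pauliZ c) (pauliZ d) := by
  unfold Commute SemiconjBy
  rw [← pauliZ_add, ← pauliZ_add, add_comm]

/-- `(1 + Z) / 2` for the product `Z` of the `σᶻ_i` over the qubits `i` with `c i = 1`. -/
def pauliZProj (c : ι → ZMod 2) : Matrix (Config ι) (Config ι) ℂ :=
  (1 / 2 : ℂ) • (1 + pauliZ c)

theorem pauliZProj_commute (c d : ι → ZMod 2) : Commute (pauliZProj c) (pauliZProj d) := by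
  have h : Commute (1 + pauliZ c) (1 + pauliZ d) :=
    (Commute.one_left _).add_left ((Commute.one_right _).add_right (pauliZ_commute c d))
  exact (h.smul_left (1 / 2 : ℂ)).smul_right (1 / 2 : ℂ)

/-- `‖ψ‖²`. -/
def normSq (ψ : Config ι → ℂ) : ℝ := ∑ s, ‖ψ s‖ ^ 2

/-- `|+⋯+⟩`. -/
def plusState : Config ι → ℂ := fun _ => ((1 / Real.sqrt 2) ^ Fintype.card ι : ℝ)

/-- `|ψ⟩⟨ψ|`. -/
def densityMatrix (ψ : Config ι → ℂ) : Matrix (Config ι) (Config ι) ℂ :=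
  Matrix.vecMulVec ψ (star ψ)

/-- `ψ` is a ground state of `H`: a normalized eigenvector for the least eigenvalue of `H`. -/
def IsGroundState (H : Matrix (Config ι) (Config ι) ℂ) (ψ : Config ι → ℂ) : Prop :=
  normSq ψ = 1 ∧ ∃ E₀ : ℝ, H *ᵥ ψ = (E₀ : ℂ) • ψ ∧
    ∀ (E : ℝ) (φ : Config ι → ℂ), φ ≠ 0 → H *ᵥ φ = (E : ℂ) • φ → E₀ ≤ E

/-- The configuration equal to `a` on `X`, to `b` on `Y` and to `c` elsewhere. -/
def glue (X Y : Set ι) (a : Config X) (b : Config Y) (c : Config ↥((X ∪ Y)ᶜ)) : Config ι :=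
  fun i => if hX : i ∈ X then a ⟨i, hX⟩ else if hY : i ∈ Y then b ⟨i, hY⟩
    else c ⟨i, fun h => h.elim hX hY⟩

/-- For disjoint sets `X`, `Y` of qubits: the reduced density matrix `ρ_{XY}` of `ρ`, all other
qubits being traced out, as an operator on `(ℂ²)^{⊗ X} ⊗ (ℂ²)^{⊗ Y}`. -/
def reduced (ρ : Matrix (Config ι) (Config ι) ℂ) (X Y : Set ι) :
    Matrix (Config X × Config Y) (Config X × Config Y) ℂ :=
  Matrix.of fun p q => ∑ c, ρ (glue X Y p.1 p.2 c) (glue X Y q.1 q.2 c)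

end Pauli

/-! ## Bipartite states -/

section Bipartite

variable {m n : Type*} [Fintype m] [Fintype n]

/-- `ρ_A = tr_B ρ_{AB}`. -/
def traceRight (ρ : Matrix (m × n) (m × n) ℂ) : Matrix m m ℂ :=
  Matrix.of fun i k => ∑ j, ρ (i, j) (k, j)

/-- `ρ_B = tr_A ρ_{AB}`. -/
def traceLeft (ρ : Matrix (m × n) (m × n) ℂ) : Matrix n n ℂ :=
  Matrix.of fun j l => ∑ i, ρ (i, j) (i, l)

/-- The partial transpose `ρ_{AB}^{T_A}`. -/
def partialTranspose (ρ : Matrix (m × n) (m × n) ℂ) : Matrix (m × n) (m × n) ℂ :=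
  Matrix.of fun p q => ρ (q.1, p.2) (p.1, q.2)

/-- The logarithmic negativity `log₂ tr |ρ_{AB}^{T_A}|`, where `|O| = √(O† O)`. -/
def logNegativity (ρ : Matrix (m × n) (m × n) ℂ) : ℝ :=
  Real.logb 2 (CFC.abs (partialTranspose ρ)).trace.re

/-- `ρ` is a density matrix: positive semidefinite with trace one. -/
def IsDensity (ρ : Matrix m m ℂ) : Prop := ρ.PosSemidef ∧ ρ.trace = 1

/-- `ρ_{AB}` is separable: a finite convex combination of product states. -/
def IsSeparableState (ρ : Matrix (m × n) (m × n) ℂ) : Prop :=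
  ∃ (N : ℕ) (p : Fin N → ℝ) (α : Fin N → Matrix m m ℂ) (β : Fin N → Matrix n n ℂ),
    (∀ i, 0 ≤ p i) ∧ ∑ i, p i = 1 ∧ (∀ i, IsDensity (α i)) ∧ (∀ i, IsDensity (β i)) ∧
      ρ = ∑ i, (p i : ℂ) • (α i ⊗ₖ β i)

end Bipartite

/-! ## Lattices on the torus -/

/-- A finite graph embedded in the torus with disks as faces, given by its rotation system.
`D` is the set of darts (edges with a direction), `rot` sends a dart to the next dart
counterclockwise around its starting vertex, `rev` reverses a dart. The surface is connected and
has Euler characteristic `0`; being orientable, it is the torus. -/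
structure TorusLattice (D : Type*) [Fintype D] where
  rot : Equiv.Perm D
  rev : Equiv.Perm D
  rev_rev : ∀ d, rev (rev d) = d
  rev_ne : ∀ d, rev d ≠ d
  nonempty : Nonempty D
  connected : ∀ d d' : D, ∃ g ∈ Subgroup.closure {rot, rev}, g d = d'
  euler : Nat.card (Quotient (Equiv.Perm.SameCycle.setoid rot))
      + Nat.card (Quotient (Equiv.Perm.SameCycle.setoid (rot⁻¹ * rev)))
      = Nat.card (Quotient (Equiv.Perm.SameCycle.setoid rev))

namespace TorusLattice

variable {D : Type*} [Fintype D] (M : TorusLattice D)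

/-- Sends a dart to the next dart along the boundary of the face on its left. -/
def next : Equiv.Perm D := M.rot⁻¹ * M.rev

/-- The vertices of the lattice. -/
def Vertex : Type _ := Quotient (Equiv.Perm.SameCycle.setoid M.rot)

/-- The edges of the lattice. -/
def Edge : Type _ := Quotient (Equiv.Perm.SameCycle.setoid M.rev)

/-- The faces of the lattice. -/
def Face : Type _ := Quotient (Equiv.Perm.SameCycle.setoid M.next)

instance : Fintype M.Vertex :=
  inferInstanceAs (Fintype (Quotient (Equiv.Perm.SameCycle.setoid M.rot)))

instance : Fintype M.Edge :=
  inferInstanceAs (Fintype (Quotient (Equiv.Perm.SameCycle.setoid M.rev)))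

instance : Fintype M.Face :=
  inferInstanceAs (Fintype (Quotient (Equiv.Perm.SameCycle.setoid M.next)))

/-- The vertex from which a dart starts. -/
def vertexOf (d : D) : M.Vertex :=
  Quotient.mk (Equiv.Perm.SameCycle.setoid M.rot) d

/-- The edge of a dart. -/
def edgeOf (d : D) : M.Edge :=
  Quotient.mk (Equiv.Perm.SameCycle.setoid M.rev) d

/-- The face on the left of a dart. -/
def faceOf (d : D) : M.Face :=
  Quotient.mk (Equiv.Perm.SameCycle.setoid M.next) d

/-- How often (mod 2) an edge occurs among the legs of the vertex `v`. -/
def legs (v : M.Vertex) : M.Edge → ZMod 2 := fun e =>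
  ((Finset.univ.filter fun d => M.vertexOf d = v ∧ M.edgeOf d = e).card : ZMod 2)

/-- How often (mod 2) an edge occurs along the boundary of the face `p`. -/
def boundary (p : M.Face) : M.Edge → ZMod 2 := fun e =>
  ((Finset.univ.filter fun d => M.faceOf d = p ∧ M.edgeOf d = e).card : ZMod 2)

/-- The star operator `A_s`. -/
def starOp (s : M.Vertex) : Matrix (Config M.Edge) (Config M.Edge) ℂ := pauliX (M.legs s)

/-- The plaquette operator `B_p`. -/
def plaquetteOp (p : M.Face) : Matrix (Config M.Edge) (Config M.Edge) ℂ := pauliZ (M.boundary p)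

/-- The toric code Hamiltonian `-U ∑ A_s - J ∑ B_p`, with one qubit on every edge. -/
def hamiltonian (U J : ℝ) : Matrix (Config M.Edge) (Config M.Edge) ℂ :=
  -((U : ℂ) • ∑ s, M.starOp s) - (J : ℂ) • ∑ p, M.plaquetteOp p

/-! ### Loops (mod 2) -/

/-- `z` is (the edge set of) a closed loop of the lattice. -/
def IsLoop (z : M.Edge → ZMod 2) : Prop := ∀ v, M.legs v ⬝ᵥ z = 0

/-- `x` is (the set of edges crossed by) a closed loop of the dual lattice. -/
def IsDualLoop (x : M.Edge → ZMod 2) : Prop := ∀ p, M.boundary p ⬝ᵥ x = 0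

/-- `z` is contractible: a sum of boundaries of faces. -/
def IsTrivial (z : M.Edge → ZMod 2) : Prop := z ∈ Submodule.span (ZMod 2) (Set.range M.boundary)

/-- `x` is contractible as a dual loop: a sum of dual loops around single vertices. -/
def IsDualTrivial (x : M.Edge → ZMod 2) : Prop := x ∈ Submodule.span (ZMod 2) (Set.range M.legs)

/-- All edges of `c` belong to `R`. -/
def SupportedOn (R : Set M.Edge) (c : M.Edge → ZMod 2) : Prop := ∀ e, c e ≠ 0 → e ∈ R

/-- A region is non-contractible if a non-contractible loop, of the lattice or of the dual
lattice, runs inside it. -/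
def IsNoncontractible (R : Set M.Edge) : Prop :=
  (∃ z, M.IsLoop z ∧ M.SupportedOn R z ∧ ¬ M.IsTrivial z) ∨
    (∃ x, M.IsDualLoop x ∧ M.SupportedOn R x ∧ ¬ M.IsDualTrivial x)

end TorusLattice

/-! ### Regions -/

/-- The names of the four regions. -/
inductive Region
  | A₁
  | A₂
  | B₁
  | B₂

/-- A division of the edges of the lattice into four non-contractible regions such that every star
and every plaquette acts on at most two regions, and none acts on both `A₁` and `B₁`. -/
structure RefinedPartition {D : Type*} [Fintype D] (M : TorusLattice D) where
  region : M.Edge → Region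
  star_le_two : ∀ s, {r | ∃ d, M.vertexOf d = s ∧ region (M.edgeOf d) = r}.ncard ≤ 2
  plaquette_le_two : ∀ p, {r | ∃ d, M.faceOf d = p ∧ region (M.edgeOf d) = r}.ncard ≤ 2
  star_apart : ∀ d d', M.vertexOf d = M.vertexOf d' →
    ¬ (region (M.edgeOf d) = Region.A₁ ∧ region (M.edgeOf d') = Region.B₁)
  plaquette_apart : ∀ d d', M.faceOf d = M.faceOf d' →
    ¬ (region (M.edgeOf d) = Region.A₁ ∧ region (M.edgeOf d') = Region.B₁)
  noncontractible : ∀ r, M.IsNoncontractible {e | region e = r}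

/-- The edges in the region `r`. -/
def RefinedPartition.part {D : Type*} [Fintype D] {M : TorusLattice D} (P : RefinedPartition M)
    (r : Region) : Set M.Edge := {e | P.region e = r}

/-! ### States with definite flux -/

/-- Loops `z₁`, `z₂` of the lattice and `x₁`, `x₂` of the dual lattice, with `z₁`, `x₁` along one
direction of the torus and `z₂`, `x₂` along the other one: loops of the same direction cross an
even number of times, loops of different directions an odd number of times. -/
structure FluxLoops {D : Type*} [Fintype D] (M : TorusLattice D) where
  (z₁ z₂ x₁ x₂ : M.Edge → ZMod 2)
  loop₁ : M.IsLoop z₁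
  loop₂ : M.IsLoop z₂
  dual₁ : M.IsDualLoop x₁
  dual₂ : M.IsDualLoop x₂
  cross₁₁ : z₁ ⬝ᵥ x₁ = 0
  cross₂₂ : z₂ ⬝ᵥ x₂ = 0
  cross₁₂ : z₁ ⬝ᵥ x₂ = 1
  cross₂₁ : z₂ ⬝ᵥ x₁ = 1

namespace FluxLoops

variable {D : Type*} [Fintype D] {M : TorusLattice D} (W : FluxLoops M)

/-- Direction `1` runs along the region `R`: up to contractible loops, `z₁` or `x₁` is a loop
inside `R`. -/
def RunsAlong (R : Set M.Edge) : Prop :=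
  (∃ z, M.SupportedOn R z ∧ M.IsTrivial (W.z₁ - z)) ∨
    (∃ x, M.SupportedOn R x ∧ M.IsDualTrivial (W.x₁ - x))

theorem plaquette_pairwise_commute (M : TorusLattice D) :
    ((Finset.univ : Finset M.Face) : Set M.Face).Pairwise
      (Function.onFun Commute fun p => pauliZProj (M.boundary p)) :=
  fun p _ q _ _ => pauliZProj_commute (M.boundary p) (M.boundary q)

/-- `∏_p ((1 + B_p) / 2) ((1 + W₁ᶻ) / 2) |+⋯+⟩`. -/
def unnormalized : Config M.Edge → ℂ :=
  (Finset.univ.noncommProd (fun p => pauliZProj (M.boundary p))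
      (plaquette_pairwise_commute M) * pauliZProj W.z₁) *ᵥ plusState

/-- The ground state `ψ_I`, an eigenstate of `W₁ᶻ` and `W₁ˣ` for the eigenvalue `+1`. -/
def psiI : Config M.Edge → ℂ :=
  ((1 / Real.sqrt (normSq W.unnormalized) : ℝ) : ℂ) • W.unnormalized

/-- The ground states `(W₂ˣ)^k (W₂ᶻ)^l ψ_I` of definite flux: `ψ_I`, `ψ_e`, `ψ_m`, `ψ_em` for
`(k, l) = (0, 0), (1, 0), (0, 1), (1, 1)`. -/
def psi (k l : Fin 2) : Config M.Edge → ℂ :=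
  (pauliX W.x₂ ^ (k : ℕ) * pauliZ W.z₂ ^ (l : ℕ)) *ᵥ W.psiI

end FluxLoops

/-- The reduced density matrix `ρ_{A₁B₁}` of the pure state `ψ`. -/
def RefinedPartition.rhoA₁B₁ {D : Type*} [Fintype D] {M : TorusLattice D}
    (P : RefinedPartition M) (ψ : Config M.Edge → ℂ) :
    Matrix (Config (P.part Region.A₁) × Config (P.part Region.B₁))
      (Config (P.part Region.A₁) × Config (P.part Region.B₁)) ℂ :=
  reduced (densityMatrix ψ) (P.part Region.A₁) (P.part Region.B₁)

end

/-! In the computational basis a configuration is a chain mod 2. A ground state is fixed by every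
star and plaquette (`FluxLoops.IsGroundState.stabilized`), so its amplitudes live on dual loops and
depend only on the homology class. Euler characteristic zero makes the homology two-dimensional
(`mem_span_of_orthogonal`), so the class is the pair of crossing parities with `z₁` and `z₂`; a
Fourier transform in the second parity gives the flux states (`exists_eq_sum_psi`).

The topological core is a push-off. A non-contractible loop in `A₁` has a parallel dual loop next to
it (`Equiv.Perm.exists_pushoff`), and conversely. Since `A₁` and `B₁` share no border, loops in `B₁`
cross neither curve, so every loop in `B₁` has direction `1` or is contractible. As `B₁` is itself
non-contractible, the argument can be reversed (`RunsAlong.onlyDirectionOne`).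

Two consequences finish the proof. First, `z₁` and `x₁` can be deformed off both regions, so the
traced-out qubits record the flux and the cross terms vanish (`sum_psi_mul_star_psi`). Second, a
flux state has, up to the signs of a character, constant amplitude on one coset of the group
`evenDualLoops`. Elements of this group supported on the two regions split, and the `A₁` part of any
element extends to one that vanishes on `B₁`. Translating by such elements gives an exchange
identity for the entries of the reduced density matrix (`reduced_mul_reduced`), which makes it a
product. The resulting mixture is separable, hence has positive partial transpose. -/

noncomputable section

/-! ## Linear algebra over `ZMod 2` -/

theorem ZMod.two_cases (a : ZMod 2) : a = 0 ∨ a = 1 := by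
  revert a; decide

theorem ZMod.two_add_self (a : ZMod 2) : a + a = 0 := CharTwo.add_self_eq_zero a

theorem ZMod.two_eq_of_add_eq_zero {a b : ZMod 2} (h : a + b = 0) : a = b :=
  CharTwo.add_eq_zero.mp h

/-- A subspace of `ι → K` contains every vector orthogonal to its orthogonal complement. -/
theorem Submodule.mem_of_forall_dotProduct_eq_zero {K ι : Type*} [Field K] [Fintype ι]
    (W : Submodule K (ι → K)) (y : ι → K)
    (h : ∀ w : ι → K, (∀ v ∈ W, w ⬝ᵥ v = 0) → w ⬝ᵥ y = 0) : y ∈ W := by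
  by_contra hy
  -- A functional that vanishes on `W` but not at `y`, read as the vector of its values on the unit
  -- vectors, is orthogonal to `W` and not to `y`.
  obtain ⟨f, hf, hW⟩ := Submodule.exists_le_ker_of_notMem hy
  have key : ∀ v, (fun i => f (Pi.single i 1)) ⬝ᵥ v = f v := by
    intro v
    conv_rhs => rw [pi_eq_sum_univ' v]
    simp only [map_sum, map_smul, dotProduct, smul_eq_mul]
    exact Finset.sum_congr rfl fun i _ => mul_comm _ _
  refine hf ?_
  rw [← key]
  exact h _ fun v hv => by rw [key]; exact hW hv

/-! ## Orbits of permutations and their incidence -/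

namespace Equiv.Perm

variable {D : Type*}

/-- The cycles of a permutation, fixed points included. -/
abbrev Orbit (σ : Perm D) : Type _ := Quotient (SameCycle.setoid σ)

/-- The orbit of a point. -/
abbrev orbitMk (σ : Perm D) (d : D) : Orbit σ := Quotient.mk (SameCycle.setoid σ) d

theorem orbitMk_eq_iff {σ : Perm D} {d d' : D} :
    orbitMk σ d = orbitMk σ d' ↔ σ.SameCycle d d' := Quotient.eq

theorem orbitMk_apply (σ : Perm D) (d : D) : orbitMk σ (σ d) = orbitMk σ d :=
  orbitMk_eq_iff.mpr (sameCycle_apply_left.mpr (SameCycle.refl _ _))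

theorem orbitMk_eq_iff_of_involution {τ : Perm D} (h : ∀ d, τ (τ d) = d) {d d' : D} :
    orbitMk τ d' = orbitMk τ d ↔ d' = d ∨ d' = τ d := by
  constructor
  · intro hd
    obtain ⟨i, rfl⟩ := orbitMk_eq_iff.mp hd.symm
    have h2 : τ ^ 2 = 1 := by ext d; simp [pow_two, h]
    rcases Int.even_or_odd' i with ⟨k, rfl | rfl⟩
    · left; rw [zpow_mul]; simp [h2]
    · right; rw [zpow_add, zpow_mul]; simp [h2]
  · rintro (rfl | rfl)
    · rfl
    · exact orbitMk_apply τ d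

theorem apply_inv_apply (σ : Perm D) (d : D) : σ (σ⁻¹ d) = d := σ.apply_symm_apply d

variable [Fintype D]

theorem eq_of_sameCycle {α : Type*} {σ : Perm D} {a : D → α} (ha : ∀ d, a (σ d) = a d) {d d' : D}
    (h : σ.SameCycle d d') : a d = a d' := by
  obtain ⟨i, rfl⟩ := h.exists_nat_pow_eq
  induction i with
  | zero => rfl
  | succ n ih => rw [pow_succ', mul_apply, ha, ← ih ⟨n, by simp⟩]

/-- A function constant along a permutation descends to the orbits. -/
def liftOrbit {α : Type*} (σ : Perm D) (a : D → α) (ha : ∀ d, a (σ d) = a d) : Orbit σ → α :=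
  Quotient.lift a fun _ _ h => eq_of_sameCycle ha h

theorem liftOrbit_mk {α : Type*} (σ : Perm D) (a : D → α) (ha : ∀ d, a (σ d) = a d) (d : D) :
    liftOrbit σ a ha (orbitMk σ d) = a d := rfl

/-- How often (mod 2) the orbits of `τ` meet the orbit `o` of `σ`. -/
def incidence (σ τ : Perm D) (o : Orbit σ) : Orbit τ → ZMod 2 := fun e =>
  ((Finset.univ.filter fun d => orbitMk σ d = o ∧ orbitMk τ d = e).card : ZMod 2)

theorem incidence_dotProduct (σ τ : Perm D) (o : Orbit σ) (z : Orbit τ → ZMod 2) :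
    incidence σ τ o ⬝ᵥ z = ∑ d with orbitMk σ d = o, z (orbitMk τ d) := by
  rw [← Finset.sum_fiberwise _ (fun d => orbitMk τ d)]
  refine Finset.sum_congr rfl fun e _ => ?_
  rw [Finset.sum_congr rfl (g := fun _ => z e)
    fun d hd => by rw [(Finset.mem_filter.mp hd).2], Finset.sum_const, Finset.filter_filter,
    nsmul_eq_mul]
  rfl

theorem sum_mul_incidence (σ τ : Perm D) (a : Orbit σ → ZMod 2) (e : Orbit τ) :
    ∑ o, a o * incidence σ τ o e = ∑ d with orbitMk τ d = e, a (orbitMk σ d) := by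
  rw [← Finset.sum_fiberwise _ (fun d => orbitMk σ d)]
  refine Finset.sum_congr rfl fun o _ => ?_
  rw [Finset.sum_congr rfl (g := fun _ => a o)
    fun d hd => by rw [(Finset.mem_filter.mp hd).2], Finset.sum_const, Finset.filter_filter,
    nsmul_eq_mul, mul_comm]
  simp only [incidence, and_comm]

theorem sum_orbit_of_involution {τ : Perm D} (h : ∀ d, τ (τ d) = d) (hne : ∀ d, τ d ≠ d)
    {A : Type*} [AddCommMonoid A] (a : D → A) (d : D) :
    ∑ d' with orbitMk τ d' = orbitMk τ d, a d' = a d + a (τ d) := by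
  have : (Finset.univ.filter fun d' => orbitMk τ d' = orbitMk τ d) = {d, τ d} := by
    ext d'
    simp [orbitMk_eq_iff_of_involution h]
  rw [this, Finset.sum_pair (hne d).symm]

theorem sum_orbits_eq_sum {τ : Perm D} (z : Orbit τ → ZMod 2) (a : D → ZMod 2) :
    ∑ e, z e * ∑ d with orbitMk τ d = e, a d = ∑ d, z (orbitMk τ d) * a d := by
  rw [← Finset.sum_fiberwise Finset.univ (fun d => orbitMk τ d)]
  refine Finset.sum_congr rfl fun e _ => ?_
  rw [Finset.mul_sum]
  exact Finset.sum_congr rfl fun d hd => by rw [(Finset.mem_filter.mp hd).2]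

/-- The potential is kept on darts, constant along `σ`, instead of on orbits; in this form a
potential on vertices and one on faces can be compared directly in the push-off. -/
theorem mem_span_incidence_iff {σ τ : Perm D} (h : ∀ d, τ (τ d) = d) (hne : ∀ d, τ d ≠ d)
    (z : Orbit τ → ZMod 2) :
    z ∈ Submodule.span (ZMod 2) (Set.range (incidence σ τ)) ↔
      ∃ a : D → ZMod 2, (∀ d, a (σ d) = a d) ∧ ∀ d, z (orbitMk τ d) = a d + a (τ d) := by
  rw [← Fintype.range_linearCombination]
  constructor
  · rintro ⟨a, rfl⟩
    refine ⟨fun d => a (orbitMk σ d), fun d => congrArg a (orbitMk_apply σ d), fun d => ?_⟩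
    rw [← sum_orbit_of_involution h hne (fun d => a (orbitMk σ d)), ← sum_mul_incidence]
    simp [Fintype.linearCombination_apply]
  · rintro ⟨a, ha, hz⟩
    refine ⟨liftOrbit σ a ha, ?_⟩
    ext e
    induction e using Quotient.inductionOn with | _ d => ?_
    change _ = z (orbitMk τ d)
    rw [hz, ← sum_orbit_of_involution h hne a]
    have := sum_mul_incidence σ τ (liftOrbit σ a ha) (orbitMk τ d)
    simp only [liftOrbit_mk] at this
    rw [← this]
    simp [Fintype.linearCombination_apply]

/-- A function on `D` with zero sum on every orbit of `σ` is a difference along `σ`; the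
potential can be taken to vanish on the orbits on which the function vanishes. -/
theorem exists_potential (σ : Perm D) (y : D → ZMod 2)
    (hy : ∀ o : Orbit σ, ∑ d with orbitMk σ d = o, y d = 0) :
    ∃ h : D → ZMod 2, (∀ d, h (σ d) = h d + y d) ∧
      ∀ d, h d ≠ 0 → ∃ d', orbitMk σ d' = orbitMk σ d ∧ y d' ≠ 0 := by
  let L : (D → ZMod 2) →ₗ[ZMod 2] (D → ZMod 2) := LinearMap.funLeft _ _ σ + LinearMap.id
  have hL : ∀ h d, L h d = h (σ d) + h d := fun _ _ => rfl
  have hmem : y ∈ LinearMap.range L := by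
    -- Duality: a vector orthogonal to the range of `L` is constant on the orbits of `σ`, and `y`
    -- sums to zero on each of them.
    refine Submodule.mem_of_forall_dotProduct_eq_zero _ _ fun w hw => ?_
    have hinv : ∀ d, w (σ d) = w d := by
      intro d
      have := hw (L (Pi.single (σ d) 1)) ⟨_, rfl⟩
      have e : L (Pi.single (σ d) 1) = Pi.single d 1 + Pi.single (σ d) 1 := by
        ext d'
        simp [hL, Pi.single_apply]
      rw [e, dotProduct_add, dotProduct_single_one, dotProduct_single_one] at this
      exact (ZMod.two_eq_of_add_eq_zero this).symm
    rw [dotProduct, ← Finset.sum_fiberwise _ (fun d => orbitMk σ d)]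
    refine Finset.sum_eq_zero fun o _ => ?_
    rw [Finset.sum_congr rfl (g := fun d => liftOrbit σ w hinv o * y d) fun d hd => by
      rw [← (Finset.mem_filter.mp hd).2, liftOrbit_mk], ← Finset.mul_sum, hy, mul_zero]
  obtain ⟨h, hh⟩ := hmem
  have hh' : ∀ d, h (σ d) = h d + y d := fun d => by
    rw [← hh, hL, add_comm (h (σ d)), ← add_assoc, ZMod.two_add_self, zero_add]
  -- Resetting the potential to zero on the orbits where `y` vanishes keeps the equation and makes
  -- the potential local.
  refine ⟨fun d => if ∃ d', orbitMk σ d' = orbitMk σ d ∧ y d' ≠ 0 then h d else 0,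
    fun d => ?_, fun d hd => ?_⟩
  · simp only [orbitMk_apply]
    split_ifs with hc
    · exact hh' d
    · push Not at hc
      rw [hc d rfl, add_zero]
  · by_contra hc
    exact hd (if_neg hc)

/-- An edge starting at a vertex as `d` borders the faces of `d` and of `σ⁻¹ d`; going around the
vertex, each face is therefore counted twice. -/
theorem incidence_dotProduct_incidence {σ τ : Perm D} (h : ∀ d, τ (τ d) = d)
    (hne : ∀ d, τ d ≠ d) (o : Orbit σ) (p : Orbit (σ⁻¹ * τ)) :
    incidence σ τ o ⬝ᵥ incidence (σ⁻¹ * τ) τ p = 0 := by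
  rw [incidence_dotProduct]
  have key : ∀ d, incidence (σ⁻¹ * τ) τ p (orbitMk τ d)
      = (if orbitMk (σ⁻¹ * τ) d = p then 1 else 0)
        + (if orbitMk (σ⁻¹ * τ) (σ⁻¹ d) = p then 1 else 0) := by
    intro d
    have h1 : orbitMk (σ⁻¹ * τ) (σ⁻¹ d) = orbitMk (σ⁻¹ * τ) (τ d) := by
      rw [← orbitMk_apply _ (τ d), mul_apply, h]
    rw [h1, ← sum_orbit_of_involution h hne
      (fun d => if orbitMk (σ⁻¹ * τ) d = p then (1 : ZMod 2) else 0)]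
    simp only [incidence, Finset.sum_boole, Finset.filter_filter, and_comm]
  simp only [key, Finset.sum_add_distrib]
  have h2 : ∑ d with orbitMk σ d = o, (if orbitMk (σ⁻¹ * τ) (σ⁻¹ d) = p then (1 : ZMod 2) else 0)
      = ∑ d with orbitMk σ d = o, if orbitMk (σ⁻¹ * τ) d = p then (1 : ZMod 2) else 0 := by
    refine Finset.sum_equiv σ⁻¹ (fun d => ?_) fun d _ => rfl
    simp only [Finset.mem_filter, Finset.mem_univ, true_and]
    rw [← orbitMk_apply σ (σ⁻¹ d), apply_inv_apply]
  rw [h2]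
  exact ZMod.two_add_self _

/-- The self-intersection of a potential: half of the jumps are upwards. -/
theorem sum_jump_mul_potential {σ τ : Perm D} (hτ : ∀ d, τ (τ d) = d) (hne : ∀ d, τ d ≠ d)
    (z : Orbit τ → ZMod 2) (h : D → ZMod 2) (hh : ∀ d, h (σ d) = h d + z (orbitMk τ d)) :
    ∑ d, z (orbitMk τ d) * h d = ∑ e, z e := by
  let J : Finset D := Finset.univ.filter fun d => z (orbitMk τ d) = 1
  have two : ∀ a : ZMod 2, a = 0 ∨ a = 1 := ZMod.two_cases
  have hJ : J.card = 2 * (Finset.univ.filter fun e => z e = 1).card := by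
    have := Finset.card_eq_sum_card_fiberwise (s := J) (f := fun d => orbitMk τ d)
      (t := Finset.univ.filter fun e => z e = 1) (fun d hd => by simpa [J] using hd)
    rw [this, Finset.sum_const_nat (m := 2), mul_comm]
    intro e he
    induction e using Quotient.inductionOn with | _ d => ?_
    have hz : z (orbitMk τ d) = 1 := (Finset.mem_filter.mp he).2
    have : (J.filter fun d' => orbitMk τ d' = orbitMk τ d) = {d, τ d} := by
      ext d'
      simp only [J, Finset.mem_filter, Finset.mem_univ, true_and, Finset.mem_insert,
        Finset.mem_singleton]
      rw [← orbitMk_eq_iff_of_involution hτ]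
      exact ⟨fun h => h.2, fun h => ⟨by rw [h, hz], h⟩⟩
    exact (congrArg Finset.card this).trans (Finset.card_pair (hne d).symm)
  -- A count has to be halved, which is impossible mod 2. Lifted to the integers, the upward and
  -- downward jumps of `h` balance exactly.
  have hlift : ∀ d, ((h (σ d)).val : ℤ) - (h d).val
      = (if z (orbitMk τ d) = 1 ∧ h d = 0 then 1 else 0)
        - (if z (orbitMk τ d) = 1 ∧ h d = 1 then 1 else 0) := by
    intro d
    rw [hh]
    rcases two (h d) with e | e <;> rcases two (z (orbitMk τ d)) with e' | e' <;>
      rw [e, e'] <;> decide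
  have hsum : ∑ d, (((h (σ d)).val : ℤ) - (h d).val) = 0 := by
    rw [Finset.sum_sub_distrib, Equiv.sum_comp σ (fun d => ((h d).val : ℤ)), sub_self]
  simp only [hlift, Finset.sum_sub_distrib, Finset.sum_boole] at hsum
  have hsplit : (Finset.univ.filter fun d => z (orbitMk τ d) = 1 ∧ h d = 0).card
      + (Finset.univ.filter fun d => z (orbitMk τ d) = 1 ∧ h d = 1).card = J.card := by
    rw [← Finset.card_union_of_disjoint]
    · congr 1
      ext d
      simp only [J, Finset.mem_union, Finset.mem_filter, Finset.mem_univ, true_and]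
      rcases two (h d) with e | e <;> simp [e]
    · refine Finset.disjoint_filter.mpr fun d _ h1 h2 => ?_
      exact absurd (h1.2.symm.trans h2.2) (by decide)
  have hcard : (Finset.univ.filter fun d => z (orbitMk τ d) = 1 ∧ h d = 1).card
      = (Finset.univ.filter fun e => z e = 1).card := by omega
  have e1 : ∑ d, z (orbitMk τ d) * h d
      = ∑ d, if z (orbitMk τ d) = 1 ∧ h d = 1 then (1 : ZMod 2) else 0 := by
    refine Finset.sum_congr rfl fun d _ => ?_
    rcases two (h d) with e | e <;> rcases two (z (orbitMk τ d)) with e' | e' <;>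
      rw [e, e'] <;> decide
  have e2 : ∑ e, z e = ∑ e, if z e = 1 then (1 : ZMod 2) else 0 := by
    refine Finset.sum_congr rfl fun e _ => ?_
    rcases two (z e) with e' | e' <;> rw [e'] <;> decide
  rw [e1, e2, Finset.sum_boole, Finset.sum_boole, hcard]

/-- Pushing a cycle off itself: a cycle `z` of the graph with vertices `Orbit σ` and edges `Orbit τ`
embedded in a surface is homologous to a cycle `x` of the dual graph that crosses `z` an even
number of times and only crosses edges that share a vertex with `z`. -/
theorem exists_pushoff {σ τ : Perm D} (hτ : ∀ d, τ (τ d) = d) (hne : ∀ d, τ d ≠ d)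
    (z : Orbit τ → ZMod 2) (hz : ∀ o, incidence σ τ o ⬝ᵥ z = 0) :
    ∃ x : Orbit τ → ZMod 2, (∀ p, incidence (σ⁻¹ * τ) τ p ⬝ᵥ x = 0) ∧ z ⬝ᵥ x = 0 ∧
      (x ∈ Submodule.span (ZMod 2) (Set.range (incidence σ τ)) →
        z ∈ Submodule.span (ZMod 2) (Set.range (incidence (σ⁻¹ * τ) τ))) ∧
      ∀ e, x e ≠ 0 → ∃ d d', orbitMk τ d = e ∧ orbitMk σ d' = orbitMk σ d ∧
        z (orbitMk τ d') ≠ 0 := by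
  simp only [incidence_dotProduct] at hz
  obtain ⟨h, hh, hsupp⟩ := exists_potential σ (fun d => z (orbitMk τ d)) hz
  have hzτ : ∀ d, z (orbitMk τ (τ d)) = z (orbitMk τ d) := fun d => by rw [orbitMk_apply]
  -- Read `h d` as the height of the corner just clockwise of `d`. Then `h (σ d)` and `h (τ d)` are
  -- the heights of the two corners to the left of `d`, one at each end, and `x` records whether
  -- they differ.
  let x : Orbit τ → ZMod 2 := liftOrbit τ (fun d => h (σ d) + h (τ d)) fun d => by
    rw [hτ, hh, hh, hzτ]; abel
  have hx : ∀ d, x (orbitMk τ d) = h (σ d) + h (τ d) := fun d => rfl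
  refine ⟨x, fun p => ?_, ?_, fun hx' => ?_, fun e he => ?_⟩
  · rw [incidence_dotProduct]
    simp only [hx, Finset.sum_add_distrib]
    have : ∑ d with orbitMk (σ⁻¹ * τ) d = p, h (τ d)
        = ∑ d with orbitMk (σ⁻¹ * τ) d = p, h (σ d) := by
      refine Finset.sum_equiv (σ⁻¹ * τ) (fun d => ?_) fun d _ => by simp
      simp only [Finset.mem_filter, Finset.mem_univ, true_and]
      rw [orbitMk_apply]
    rw [this]
    exact ZMod.two_add_self _
  · have hx2 : ∀ e, x e = z e + ∑ d with orbitMk τ d = e, h d := by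
      intro e
      induction e using Quotient.inductionOn with | _ d => ?_
      change x (orbitMk τ d) = z (orbitMk τ d) + ∑ d' with orbitMk τ d' = orbitMk τ d, h d'
      rw [sum_orbit_of_involution hτ hne, hx, hh, add_comm (h d), add_assoc]
    have hzz : ∀ a : ZMod 2, a * a = a := by decide
    rw [dotProduct]
    simp only [hx2, mul_add, Finset.sum_add_distrib, hzz]
    rw [sum_orbits_eq_sum, sum_jump_mul_potential hτ hne z h hh]
    exact ZMod.two_add_self _
  · rw [mem_span_incidence_iff hτ hne] at hx' ⊢
    obtain ⟨a, ha, hxa⟩ := hx'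
    have key : ∀ d, h (σ d) + a (σ d) = h (τ d) + a (τ d) := by
      intro d
      have := hxa d
      rw [hx] at this
      apply ZMod.two_eq_of_add_eq_zero
      rw [ha, add_add_add_comm, this]
      exact ZMod.two_add_self _
    -- If `x` is the coboundary of `a`, the corrected height `h + a` agrees at all corners of a face
    -- and jumps exactly across `z`, so `z` is the boundary of the faces of height one.
    refine ⟨fun d => h (σ d) + a (σ d), fun d => ?_, fun d => ?_⟩
    · simp only [mul_apply, apply_inv_apply]
      exact (key d).symm
    · have := key (τ d)
      rw [hτ] at this
      simp only [this]
      rw [hh, ha]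
      generalize h d = p
      generalize a d = q
      generalize z (orbitMk τ d) = r
      revert p q r
      decide
  · induction e using Quotient.inductionOn with | _ d => ?_
    change h (σ d) + h (τ d) ≠ 0 at he
    by_cases h1 : h (σ d) = 0
    · rw [h1, zero_add] at he
      obtain ⟨d', hd', hz'⟩ := hsupp _ he
      exact ⟨τ d, d', orbitMk_apply τ d, hd', hz'⟩
    · obtain ⟨d', hd', hz'⟩ := hsupp _ h1
      rw [orbitMk_apply] at hd'
      exact ⟨d, d', rfl, hd', hz'⟩

/-- The rank of the vertex-edge incidence of a connected graph. -/
theorem finrank_span_incidence {σ τ : Perm D} [Nonempty D] (hτ : ∀ d, τ (τ d) = d)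
    (hne : ∀ d, τ d ≠ d)
    (hconn : ∀ a : D → ZMod 2, (∀ d, a (σ d) = a d) → (∀ d, a (τ d) = a d) → ∀ d d', a d = a d') :
    Module.finrank (ZMod 2) (Submodule.span (ZMod 2) (Set.range (incidence σ τ))) + 1
      = Fintype.card (Orbit σ) := by
  have hrank := LinearMap.finrank_range_add_finrank_ker
    (Fintype.linearCombination (ZMod 2) (incidence σ τ))
  rw [Fintype.range_linearCombination, Module.finrank_fintype_fun_eq_card] at hrank
  rw [← hrank]
  congr 1
  have hker : LinearMap.ker (Fintype.linearCombination (ZMod 2) (incidence σ τ))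
      = Submodule.span (ZMod 2) {fun _ : Orbit σ => (1 : ZMod 2)} := by
    ext a
    have hval : ∀ d, Fintype.linearCombination (ZMod 2) (incidence σ τ) a (orbitMk τ d)
        = a (orbitMk σ d) + a (orbitMk σ (τ d)) := by
      intro d
      rw [← sum_orbit_of_involution hτ hne (fun d => a (orbitMk σ d)), ← sum_mul_incidence]
      simp [Fintype.linearCombination_apply]
    rw [LinearMap.mem_ker, Submodule.mem_span_singleton]
    constructor
    · intro h0
      obtain ⟨d₀⟩ := ‹Nonempty D›
      refine ⟨a (orbitMk σ d₀), ?_⟩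
      ext o
      induction o using Quotient.inductionOn with | _ d => ?_
      have := hconn (fun d => a (orbitMk σ d)) (fun d => by rw [orbitMk_apply]) (fun d => by
        have := hval d
        rw [h0] at this
        exact (ZMod.two_eq_of_add_eq_zero this.symm).symm) d₀ d
      simpa using this
    · rintro ⟨c, rfl⟩
      ext e
      induction e using Quotient.inductionOn with | _ d => ?_
      exact (hval d).trans (ZMod.two_add_self _)
  rw [hker, finrank_span_singleton]
  intro h0
  obtain ⟨d₀⟩ := ‹Nonempty D›
  exact one_ne_zero (congrFun h0 (orbitMk σ d₀))

/-- Conjugating `σ` by `τ` does not change which orbits of `τ` the orbits of `σ` meet. -/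
theorem exists_incidence_conj {σ τ ρ : Perm D} (hτ : ∀ d, τ (τ d) = d)
    (hρ : ∀ d, ρ d = τ (σ (τ d))) (d : D) :
    incidence ρ τ (orbitMk ρ d) = incidence σ τ (orbitMk σ (τ d)) := by
  have hinv : τ⁻¹ = τ := by
    ext d
    rw [inv_eq_iff_eq, hτ]
  have hconj : ρ = τ * σ * τ⁻¹ := by
    ext d
    rw [hinv, hρ]
    rfl
  have horb : ∀ d d', orbitMk ρ d = orbitMk ρ d' ↔ orbitMk σ (τ d) = orbitMk σ (τ d') := by
    intro d d'
    rw [orbitMk_eq_iff, orbitMk_eq_iff, hconj, sameCycle_conj, hinv]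
  ext e
  simp only [incidence]
  congr 1
  refine Finset.card_equiv τ fun d' => ?_
  simp only [Finset.mem_filter, Finset.mem_univ, true_and, horb, orbitMk_apply]

theorem range_incidence_conj {σ τ ρ : Perm D} (hτ : ∀ d, τ (τ d) = d)
    (hρ : ∀ d, ρ d = τ (σ (τ d))) :
    Set.range (incidence ρ τ) = Set.range (incidence σ τ) := by
  ext f
  constructor
  · rintro ⟨o, rfl⟩
    induction o using Quotient.inductionOn with | _ d => ?_
    exact ⟨orbitMk σ (τ d), (exists_incidence_conj hτ hρ d).symm⟩
  · rintro ⟨o, rfl⟩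
    induction o using Quotient.inductionOn with | _ d => ?_
    refine ⟨orbitMk ρ (τ d), (exists_incidence_conj hτ hρ (τ d)).trans ?_⟩
    rw [hτ]

end Equiv.Perm

/-! ## Homology of the lattice -/

namespace TorusLattice

open Equiv.Perm

variable {D : Type*} [Fintype D] (M : TorusLattice D)

theorem card_filter_congr_iff {p q : D → Prop} {i : DecidablePred p} {j : DecidablePred q}
    (h : ∀ d, p d ↔ q d) : (Finset.univ.filter p).card = (Finset.univ.filter q).card :=
  congrArg Finset.card (Finset.filter_congr fun d _ => h d)

theorem legs_eq_incidence : M.legs = incidence M.rot M.rev := by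
  funext v e
  exact congrArg _ (card_filter_congr_iff fun d => Iff.rfl)

theorem boundary_eq_incidence : M.boundary = incidence (M.rot⁻¹ * M.rev) M.rev := by
  funext v e
  exact congrArg _ (card_filter_congr_iff fun d => Iff.rfl)

theorem conj_next (d : D) : ((M.rot⁻¹ * M.rev)⁻¹ * M.rev) d = M.rev (M.rot (M.rev d)) := by
  rw [mul_inv_rev, inv_inv]
  have : M.rev⁻¹ = M.rev := by
    ext d
    rw [inv_eq_iff_eq, M.rev_rev]
  rw [this]
  rfl

theorem legs_dotProduct_boundary (v : M.Vertex) (p : M.Face) : M.legs v ⬝ᵥ M.boundary p = 0 := by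
  rw [legs_eq_incidence, boundary_eq_incidence]
  exact incidence_dotProduct_incidence M.rev_rev M.rev_ne v p

variable {M}

/-- A vector orthogonal to a family is orthogonal to its span. -/
theorem dotProduct_eq_zero_of_mem_span {ι κ : Type*} [Fintype ι] {f : κ → ι → ZMod 2}
    {x y : ι → ZMod 2} (hx : ∀ k, f k ⬝ᵥ x = 0)
    (hy : y ∈ Submodule.span (ZMod 2) (Set.range f)) : y ⬝ᵥ x = 0 := by
  induction hy using Submodule.span_induction with
  | mem y hy => obtain ⟨k, rfl⟩ := hy; exact hx k
  | zero => exact zero_dotProduct x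
  | add a b _ _ ha hb => rw [add_dotProduct, ha, hb, add_zero]
  | smul c a _ ha => rw [smul_dotProduct, ha, smul_zero]

theorem IsLoop.dotProduct_dualTrivial {z x : M.Edge → ZMod 2} (hz : M.IsLoop z)
    (hx : M.IsDualTrivial x) : z ⬝ᵥ x = 0 := by
  rw [dotProduct_comm]
  exact dotProduct_eq_zero_of_mem_span hz hx

theorem IsDualLoop.trivial_dotProduct {z x : M.Edge → ZMod 2} (hx : M.IsDualLoop x)
    (hz : M.IsTrivial z) : z ⬝ᵥ x = 0 :=
  dotProduct_eq_zero_of_mem_span hx hz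

theorem IsTrivial.isLoop {z : M.Edge → ZMod 2} (hz : M.IsTrivial z) : M.IsLoop z := fun v => by
  rw [dotProduct_comm]
  exact dotProduct_eq_zero_of_mem_span
    (fun p => by rw [dotProduct_comm]; exact M.legs_dotProduct_boundary v p) hz

theorem IsDualTrivial.isDualLoop {x : M.Edge → ZMod 2} (hx : M.IsDualTrivial x) :
    M.IsDualLoop x := fun p => by
  rw [dotProduct_comm]
  exact dotProduct_eq_zero_of_mem_span (fun v => M.legs_dotProduct_boundary v p) hx

theorem IsLoop.add {z z' : M.Edge → ZMod 2} (h : M.IsLoop z) (h' : M.IsLoop z') :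
    M.IsLoop (z + z') := fun v => by rw [dotProduct_add, h, h', add_zero]

theorem IsLoop.sub {z z' : M.Edge → ZMod 2} (h : M.IsLoop z) (h' : M.IsLoop z') :
    M.IsLoop (z - z') := fun v => by rw [dotProduct_sub, h, h', sub_zero]

theorem IsLoop.smul {z : M.Edge → ZMod 2} (c : ZMod 2) (h : M.IsLoop z) :
    M.IsLoop (c • z) := fun v => by rw [dotProduct_smul, h, smul_zero]

theorem IsDualLoop.add {x x' : M.Edge → ZMod 2} (h : M.IsDualLoop x) (h' : M.IsDualLoop x') :
    M.IsDualLoop (x + x') := fun v => by rw [dotProduct_add, h, h', add_zero]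

theorem IsDualLoop.sub {x x' : M.Edge → ZMod 2} (h : M.IsDualLoop x) (h' : M.IsDualLoop x') :
    M.IsDualLoop (x - x') := fun v => by rw [dotProduct_sub, h, h', sub_zero]

theorem IsDualLoop.smul {x : M.Edge → ZMod 2} (c : ZMod 2) (h : M.IsDualLoop x) :
    M.IsDualLoop (c • x) := fun v => by rw [dotProduct_smul, h, smul_zero]

/-- A loop that crosses every dual loop evenly is contractible. -/
theorem isTrivial_of_forall {z : M.Edge → ZMod 2}
    (h : ∀ x, M.IsDualLoop x → x ⬝ᵥ z = 0) : M.IsTrivial z :=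
  Submodule.mem_of_forall_dotProduct_eq_zero _ _ fun w hw => h w fun p => by
    rw [dotProduct_comm]
    exact hw _ (Submodule.subset_span ⟨p, rfl⟩)

/-- A dual loop that crosses every loop evenly is contractible. -/
theorem isDualTrivial_of_forall {x : M.Edge → ZMod 2}
    (h : ∀ z, M.IsLoop z → z ⬝ᵥ x = 0) : M.IsDualTrivial x :=
  Submodule.mem_of_forall_dotProduct_eq_zero _ _ fun w hw => h w fun p => by
    rw [dotProduct_comm]
    exact hw _ (Submodule.subset_span ⟨p, rfl⟩)

theorem IsLoop.exists_pushoff {z : M.Edge → ZMod 2} (hz : M.IsLoop z) :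
    ∃ x, M.IsDualLoop x ∧ z ⬝ᵥ x = 0 ∧ (M.IsDualTrivial x → M.IsTrivial z) ∧
      ∀ e, x e ≠ 0 → ∃ d d', M.edgeOf d = e ∧ M.vertexOf d' = M.vertexOf d ∧
        z (M.edgeOf d') ≠ 0 := by
  unfold IsLoop at hz
  unfold IsDualLoop IsDualTrivial IsTrivial
  rw [legs_eq_incidence] at hz ⊢
  rw [boundary_eq_incidence]
  exact Equiv.Perm.exists_pushoff M.rev_rev M.rev_ne z hz

/-- This is the push-off on the dual lattice. The dual of the dual is the original lattice only up
to conjugation by `rev`, so star vectors are compared through their range. -/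
theorem IsDualLoop.exists_pushoff {x : M.Edge → ZMod 2} (hx : M.IsDualLoop x) :
    ∃ z, M.IsLoop z ∧ x ⬝ᵥ z = 0 ∧ (M.IsTrivial z → M.IsDualTrivial x) ∧
      ∀ e, z e ≠ 0 → ∃ d d', M.edgeOf d = e ∧ M.faceOf d' = M.faceOf d ∧
        x (M.edgeOf d') ≠ 0 := by
  unfold IsDualLoop at hx
  unfold IsLoop IsDualTrivial IsTrivial
  rw [boundary_eq_incidence] at hx ⊢
  rw [legs_eq_incidence]
  obtain ⟨z, hz, hxz, htriv, hsupp⟩ := Equiv.Perm.exists_pushoff M.rev_rev M.rev_ne x hx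
  have hrange := range_incidence_conj M.rev_rev M.conj_next
  refine ⟨z, fun v => ?_, hxz, fun h => ?_, hsupp⟩
  · obtain ⟨o, ho⟩ := hrange.symm.subset ⟨v, rfl⟩
    rw [← ho]
    exact hz o
  · exact (congrArg (Submodule.span (ZMod 2)) hrange).le (htriv h)

theorem eq_of_invariant (M : TorusLattice D) {α : Type*} (a : D → α) (h : ∀ d, a (M.rot d) = a d)
    (h' : ∀ d, a (M.rev d) = a d) (d d' : D) : a d = a d' := by
  obtain ⟨g, hg, rfl⟩ := M.connected d d'
  induction hg using Subgroup.closure_induction generalizing d with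
  | mem g hg =>
    rcases hg with rfl | rfl
    · exact (h d).symm
    · exact (h' d).symm
  | one => rfl
  | mul g g' _ _ hg hg' => rw [mul_apply, ← hg, ← hg']
  | inv g _ hg => rw [hg (g⁻¹ d), apply_inv_apply]

theorem finrank_span_legs (M : TorusLattice D) :
    Module.finrank (ZMod 2) (Submodule.span (ZMod 2) (Set.range M.legs)) + 1
      = Fintype.card M.Vertex := by
  have := M.nonempty
  rw [legs_eq_incidence]
  exact finrank_span_incidence M.rev_rev M.rev_ne M.eq_of_invariant

theorem finrank_span_boundary (M : TorusLattice D) :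
    Module.finrank (ZMod 2) (Submodule.span (ZMod 2) (Set.range M.boundary)) + 1
      = Fintype.card M.Face := by
  have := M.nonempty
  rw [boundary_eq_incidence]
  refine finrank_span_incidence M.rev_rev M.rev_ne fun a h h' => M.eq_of_invariant a (fun d => ?_) h'
  -- The face permutation sends `rev (rot d)` to `d`, so invariance under it and under `rev` gives
  -- invariance under `rot`.
  have := h (M.rev (M.rot d))
  rw [mul_apply, M.rev_rev, h'] at this
  rw [← this]
  congr 1
  exact M.rot.symm_apply_apply d

theorem card_vertex_add_card_face (M : TorusLattice D) :
    Fintype.card M.Vertex + Fintype.card M.Face = Fintype.card M.Edge := by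
  have := M.euler
  simp only [← Nat.card_eq_fintype_card]
  exact this

end TorusLattice

/-! ## Loops of definite direction -/

namespace FluxLoops

open TorusLattice

variable {D : Type*} [Fintype D] {M : TorusLattice D} (W : FluxLoops M)

/-- The vectors orthogonal to the span of `f` form a subspace of complementary dimension. -/
theorem finrank_orthogonal {ι κ : Type*} [Fintype ι] [Fintype κ] (f : κ → ι → ZMod 2) :
    Module.finrank (ZMod 2) (Submodule.span (ZMod 2) (Set.range f))
      + Module.finrank (ZMod 2) (LinearMap.ker (Matrix.mulVecLin (Matrix.of f)))
      = Fintype.card ι := by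
  have := LinearMap.finrank_range_add_finrank_ker (Matrix.mulVecLin (Matrix.of f))
  rw [Module.finrank_fintype_fun_eq_card] at this
  rw [← this]
  congr 1
  exact (Matrix.rank_eq_finrank_span_row (Matrix.of f)).symm

/-- The orthogonal complement of `f` contains the span of `g` with codimension two. Pairing with `a`
and `b` maps it onto a two-dimensional space, as `u` and `v` show, and kills the span of `g`; by
dimension that span is the whole kernel. -/
theorem mem_span_of_orthogonal {ι κ μ : Type*} [Fintype ι] [Fintype κ] [Fintype μ]
    (f : κ → ι → ZMod 2) (g : μ → ι → ZMod 2) (hfg : ∀ k m, f k ⬝ᵥ g m = 0)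
    (hdim : Fintype.card ι = Module.finrank (ZMod 2) (Submodule.span (ZMod 2) (Set.range f))
      + Module.finrank (ZMod 2) (Submodule.span (ZMod 2) (Set.range g)) + 2)
    (a b u v x : ι → ZMod 2) (ha : ∀ m, g m ⬝ᵥ a = 0) (hb : ∀ m, g m ⬝ᵥ b = 0)
    (hu : ∀ k, f k ⬝ᵥ u = 0) (hv : ∀ k, f k ⬝ᵥ v = 0)
    (hau : a ⬝ᵥ u = 0) (hav : a ⬝ᵥ v = 1) (hbu : b ⬝ᵥ u = 1) (hbv : b ⬝ᵥ v = 0)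
    (hx : ∀ k, f k ⬝ᵥ x = 0) (hax : a ⬝ᵥ x = 0) (hbx : b ⬝ᵥ x = 0) :
    x ∈ Submodule.span (ZMod 2) (Set.range g) := by
  let V := LinearMap.ker (Matrix.mulVecLin (Matrix.of f))
  have hV : ∀ y, y ∈ V ↔ ∀ k, f k ⬝ᵥ y = 0 := fun y => by
    rw [LinearMap.mem_ker, Matrix.mulVecLin_apply]
    exact funext_iff
  let B : (ι → ZMod 2) →ₗ[ZMod 2] (Fin 2 → ZMod 2) := Matrix.mulVecLin (Matrix.of ![a, b])
  have hB : ∀ y, B y = ![a ⬝ᵥ y, b ⬝ᵥ y] := fun y => by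
    ext i
    fin_cases i <;> rfl
  let B' := B.domRestrict V
  have hsurj : Function.Surjective B' := by
    intro c
    refine ⟨⟨c 1 • u + c 0 • v, (hV _).mpr fun k => by simp [dotProduct_add, hu, hv]⟩, ?_⟩
    rw [LinearMap.domRestrict_apply, hB]
    ext i
    fin_cases i <;> simp [dotProduct_add, hau, hav, hbu, hbv]
  have hrank := LinearMap.finrank_range_add_finrank_ker B'
  rw [LinearMap.range_eq_top.mpr hsurj, finrank_top, Module.finrank_fintype_fun_eq_card,
    Fintype.card_fin] at hrank
  have hV' : Module.finrank (ZMod 2) (Submodule.span (ZMod 2) (Set.range f))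
      + Module.finrank (ZMod 2) V = _ := finrank_orthogonal f
  let K := (LinearMap.ker B').map V.subtype
  have hK : Module.finrank (ZMod 2) K = Module.finrank (ZMod 2) (LinearMap.ker B') :=
    Submodule.finrank_map_subtype_eq V _
  have hle : Submodule.span (ZMod 2) (Set.range g) ≤ K := by
    rw [Submodule.span_le]
    rintro _ ⟨m, rfl⟩
    refine ⟨⟨g m, (hV _).mpr fun k => hfg k m⟩, ?_, rfl⟩
    change B (g m) = 0
    rw [hB, dotProduct_comm, ha, dotProduct_comm, hb]
    ext i
    fin_cases i <;> rfl
  have heq := Submodule.eq_of_le_of_finrank_eq hle (by omega)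
  rw [heq]
  refine ⟨⟨x, (hV _).mpr hx⟩, ?_, rfl⟩
  change B x = 0
  rw [hB, hax, hbx]
  ext i
  fin_cases i <;> rfl

theorem isDualTrivial_of_dotProduct {x : M.Edge → ZMod 2} (hx : M.IsDualLoop x)
    (h₁ : W.z₁ ⬝ᵥ x = 0) (h₂ : W.z₂ ⬝ᵥ x = 0) : M.IsDualTrivial x := by
  have hs := M.finrank_span_legs
  have hb := M.finrank_span_boundary
  have he := M.card_vertex_add_card_face
  exact mem_span_of_orthogonal M.boundary M.legs
    (fun p v => by rw [dotProduct_comm]; exact M.legs_dotProduct_boundary v p) (by omega)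
    W.z₁ W.z₂ W.x₁ W.x₂ x W.loop₁ W.loop₂ W.dual₁ W.dual₂ W.cross₁₁ W.cross₁₂ W.cross₂₁ W.cross₂₂
    hx h₁ h₂

theorem isTrivial_of_dotProduct {z : M.Edge → ZMod 2} (hz : M.IsLoop z)
    (h₁ : W.x₁ ⬝ᵥ z = 0) (h₂ : W.x₂ ⬝ᵥ z = 0) : M.IsTrivial z := by
  have hs := M.finrank_span_legs
  have hb := M.finrank_span_boundary
  have he := M.card_vertex_add_card_face
  exact mem_span_of_orthogonal M.legs M.boundary M.legs_dotProduct_boundary (by omega)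
    W.x₁ W.x₂ W.z₁ W.z₂ z W.dual₁ W.dual₂ W.loop₁ W.loop₂
    (by rw [dotProduct_comm, W.cross₁₁]) (by rw [dotProduct_comm, W.cross₂₁])
    (by rw [dotProduct_comm, W.cross₁₂]) (by rw [dotProduct_comm, W.cross₂₂])
    hz h₁ h₂

/-- Homology mod 2 has four classes and pairing with `z₁` is a nonzero functional, so its kernel has
a single nonzero class, that of `x₁`. -/
theorem isDualTrivial_x₁_sub {x : M.Edge → ZMod 2} (hx : M.IsDualLoop x)
    (h : W.z₁ ⬝ᵥ x = 0) (hne : ¬ M.IsDualTrivial x) : M.IsDualTrivial (W.x₁ - x) := by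
  refine W.isDualTrivial_of_dotProduct (W.dual₁.sub hx) ?_ ?_
  · rw [dotProduct_sub, W.cross₁₁, h, sub_zero]
  · rw [dotProduct_sub, W.cross₂₁]
    rcases ZMod.two_cases (W.z₂ ⬝ᵥ x) with e | e
    · exact absurd (W.isDualTrivial_of_dotProduct hx h e) hne
    · rw [e, sub_self]

theorem isTrivial_z₁_sub {z : M.Edge → ZMod 2} (hz : M.IsLoop z)
    (h : W.x₁ ⬝ᵥ z = 0) (hne : ¬ M.IsTrivial z) : M.IsTrivial (W.z₁ - z) := by
  refine W.isTrivial_of_dotProduct (W.loop₁.sub hz) ?_ ?_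
  · rw [dotProduct_sub, dotProduct_comm, W.cross₁₁, h, sub_zero]
  · rw [dotProduct_sub, dotProduct_comm, W.cross₁₂]
    rcases ZMod.two_cases (W.x₂ ⬝ᵥ z) with e | e
    · exact absurd (W.isTrivial_of_dotProduct hz h e) hne
    · rw [e, sub_self]

theorem not_isTrivial_z₁ : ¬ M.IsTrivial W.z₁ := fun h => by
  have := W.dual₂.trivial_dotProduct h
  rw [W.cross₁₂] at this
  exact one_ne_zero this

theorem not_isDualTrivial_x₁ : ¬ M.IsDualTrivial W.x₁ := fun h => by
  have := W.loop₂.dotProduct_dualTrivial h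
  rw [W.cross₂₁] at this
  exact one_ne_zero this

/-- Loops of direction `1` that cross evenly can be completed by loops of the other direction. -/
theorem exists_of_dotProduct_eq_zero {z x : M.Edge → ZMod 2} (hz : M.IsLoop z)
    (hx : M.IsDualLoop x) (hzx : z ⬝ᵥ x = 0) (hz' : ¬ M.IsTrivial z) (hx' : ¬ M.IsDualTrivial x) :
    ∃ W : FluxLoops M, W.z₁ = z ∧ W.x₁ = x := by
  obtain ⟨y, hy, hzy⟩ : ∃ y, M.IsDualLoop y ∧ z ⬝ᵥ y = 1 := by
    by_contra! hc
    refine hz' (isTrivial_of_forall fun y hy => ?_)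
    rw [dotProduct_comm]
    exact (ZMod.two_cases _).resolve_right (hc y hy)
  obtain ⟨w, hw, hwx⟩ : ∃ w, M.IsLoop w ∧ w ⬝ᵥ x = 1 := by
    by_contra! hc
    exact hx' (isDualTrivial_of_forall fun w hw => (ZMod.two_cases _).resolve_right (hc w hw))
  -- Adding `z` when `w` crosses `y` oddly makes that crossing even; the crossing with `x` is
  -- unaffected because `z` crosses `x` evenly.
  refine ⟨⟨z, w + (w ⬝ᵥ y) • z, x, y, hz, hw.add (hz.smul _), hx, hy, hzx, ?_, hzy, ?_⟩, rfl, rfl⟩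
  · rw [add_dotProduct, smul_dotProduct, hzy, smul_eq_mul, mul_one]
    exact ZMod.two_add_self _
  · rw [add_dotProduct, smul_dotProduct, hzx, smul_zero, hwx, add_zero]

/-- The region supplies a loop of only one type; its push-off is the companion of the other type in
the same direction. -/
theorem exists_runsAlong {R : Set M.Edge} (hR : M.IsNoncontractible R) :
    ∃ W : FluxLoops M, W.RunsAlong R := by
  rcases hR with ⟨z, hz, hs, hne⟩ | ⟨x, hx, hs, hne⟩
  · obtain ⟨x, hx, hzx, htriv, -⟩ := hz.exists_pushoff
    obtain ⟨W, rfl, -⟩ := exists_of_dotProduct_eq_zero hz hx hzx hne fun h => hne (htriv h)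
    exact ⟨W, Or.inl ⟨_, hs, by rw [sub_self]; exact Submodule.zero_mem _⟩⟩
  · obtain ⟨z, hz, hzx, htriv, -⟩ := hx.exists_pushoff
    obtain ⟨W, -, rfl⟩ := exists_of_dotProduct_eq_zero hz hx (by rwa [dotProduct_comm])
      (fun h => hne (htriv h)) hne
    exact ⟨W, Or.inr ⟨_, hs, by rw [sub_self]; exact Submodule.zero_mem _⟩⟩

/-! ### Regions without common border and the directions of their loops -/

/-- No star or plaquette acts on both `X` and `Y`. -/
def Apart (M : TorusLattice D) (X Y : Set M.Edge) : Prop :=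
  ∀ d d', M.vertexOf d = M.vertexOf d' ∨ M.faceOf d = M.faceOf d' →
    ¬ (M.edgeOf d ∈ X ∧ M.edgeOf d' ∈ Y)

theorem Apart.symm {X Y : Set M.Edge} (h : Apart M X Y) : Apart M Y X :=
  fun d d' hd hXY => h d' d (hd.imp Eq.symm Eq.symm) hXY.symm

theorem Apart.disjoint {X Y : Set M.Edge} (h : Apart M X Y) : Disjoint X Y := by
  rw [Set.disjoint_left]
  intro e hX hY
  induction e using Quotient.inductionOn with | _ d => ?_
  exact h d d (Or.inl rfl) ⟨hX, hY⟩

/-- Every loop and every dual loop in `R` has direction `1` or is contractible. -/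
def OnlyDirectionOne (R : Set M.Edge) : Prop :=
  (∀ x, M.IsDualLoop x → M.SupportedOn R x → W.z₁ ⬝ᵥ x = 0) ∧
    ∀ z, M.IsLoop z → M.SupportedOn R z → W.x₁ ⬝ᵥ z = 0

theorem dotProduct_eq_zero_of_supports {ι : Type*} [Fintype ι] {x y : ι → ZMod 2}
    (h : ∀ e, x e ≠ 0 → y e ≠ 0 → False) : x ⬝ᵥ y = 0 :=
  Finset.sum_eq_zero fun e _ => by
    by_contra hc
    exact h e (left_ne_zero_of_mul hc) (right_ne_zero_of_mul hc)

variable {W}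

/-- The curve in `X` is disjoint from `Y`. Its push-off may leave `X`, but each of its edges shares
a vertex or face with the curve, hence lies outside `Y`. These two curves represent `z₁` and `x₁`,
and nothing inside `Y` crosses them. -/
theorem RunsAlong.onlyDirectionOne_apart {X Y : Set M.Edge} (hW : W.RunsAlong X)
    (hXY : Apart M X Y) : W.OnlyDirectionOne Y := by
  have hdis : ∀ e, e ∈ X → e ∈ Y → False := fun _ h => Set.disjoint_left.mp hXY.disjoint h
  rcases hW with ⟨z, hs, ht⟩ | ⟨x, hs, ht⟩
  · have hz : M.IsLoop z := by
      have := W.loop₁.sub ht.isLoop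
      rwa [sub_sub_cancel] at this
    have hzeq : ∀ y, M.IsDualLoop y → W.z₁ ⬝ᵥ y = z ⬝ᵥ y := fun y hy => by
      rw [← sub_eq_zero, ← sub_dotProduct]
      exact hy.trivial_dotProduct ht
    have hne : ¬ M.IsTrivial z := fun h => W.not_isTrivial_z₁ (by
      have := Submodule.add_mem _ ht h
      rwa [sub_add_cancel] at this)
    obtain ⟨x, hx, hzx, htriv, hsupp⟩ := hz.exists_pushoff
    have hx₁ := W.isDualTrivial_x₁_sub hx (by rw [hzeq x hx, hzx]) fun h => hne (htriv h)
    refine ⟨fun y hy hys => ?_, fun y hy hys => ?_⟩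
    · rw [hzeq y hy]
      exact dotProduct_eq_zero_of_supports fun e h h' => hdis e (hs e h) (hys e h')
    · have h0 := hy.dotProduct_dualTrivial hx₁
      rw [dotProduct_sub, sub_eq_zero] at h0
      rw [dotProduct_comm, h0]
      refine dotProduct_eq_zero_of_supports fun e h h' => ?_
      obtain ⟨d, d', rfl, hv, hz'⟩ := hsupp e h'
      exact hXY d' d (Or.inl hv) ⟨hs _ hz', hys _ h⟩
  · have hx : M.IsDualLoop x := by
      have := W.dual₁.sub ht.isDualLoop
      rwa [sub_sub_cancel] at this
    have hxeq : ∀ y, M.IsLoop y → W.x₁ ⬝ᵥ y = x ⬝ᵥ y := fun y hy => by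
      rw [← sub_eq_zero, ← sub_dotProduct, dotProduct_comm]
      exact hy.dotProduct_dualTrivial ht
    have hne : ¬ M.IsDualTrivial x := fun h => W.not_isDualTrivial_x₁ (by
      have := Submodule.add_mem _ ht h
      rwa [sub_add_cancel] at this)
    obtain ⟨z, hz, hxz, htriv, hsupp⟩ := hx.exists_pushoff
    have hz₁ := W.isTrivial_z₁_sub hz (by rw [hxeq z hz, hxz]) fun h => hne (htriv h)
    refine ⟨fun y hy hys => ?_, fun y hy hys => ?_⟩
    · have h0 := hy.trivial_dotProduct hz₁
      rw [sub_dotProduct, sub_eq_zero] at h0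
      rw [h0]
      refine dotProduct_eq_zero_of_supports fun e h h' => ?_
      obtain ⟨d, d', rfl, hv, hx'⟩ := hsupp e h
      exact hXY d' d (Or.inr hv) ⟨hs _ hx', hys _ h'⟩
    · rw [hxeq y hy]
      exact dotProduct_eq_zero_of_supports fun e h h' => hdis e (hs e h) (hys e h')

theorem OnlyDirectionOne.runsAlong {R : Set M.Edge} (h : W.OnlyDirectionOne R)
    (hR : M.IsNoncontractible R) : W.RunsAlong R := by
  rcases hR with ⟨z, hz, hs, hne⟩ | ⟨x, hx, hs, hne⟩
  · exact Or.inl ⟨z, hs, W.isTrivial_z₁_sub hz (h.2 z hz hs) hne⟩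
  · exact Or.inr ⟨x, hs, W.isDualTrivial_x₁_sub hx (h.1 x hx hs) hne⟩

/-- The constraint passes from the region along which direction `1` runs to the other one. There
non-contractibility makes direction `1` run along that region too, and the constraint passes back.
-/
theorem RunsAlong.onlyDirectionOne {X Y : Set M.Edge} (hXY : Apart M X Y)
    (hX : M.IsNoncontractible X) (hY : M.IsNoncontractible Y)
    (hW : W.RunsAlong X ∨ W.RunsAlong Y) : W.OnlyDirectionOne X ∧ W.OnlyDirectionOne Y := by
  rcases hW with hW | hW
  · have h := hW.onlyDirectionOne_apart hXY
    exact ⟨(h.runsAlong hY).onlyDirectionOne_apart hXY.symm, h⟩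
  · have h := hW.onlyDirectionOne_apart hXY.symm
    exact ⟨h, (h.runsAlong hX).onlyDirectionOne_apart hXY⟩

end FluxLoops

/-! ## Action of the Pauli operators -/

/-- The sign `(-1)^a`. -/
def zmodSign (a : ZMod 2) : ℂ := if a = 0 then 1 else -1

theorem zmodSign_zero : zmodSign 0 = 1 := if_pos rfl

theorem zmodSign_one : zmodSign 1 = -1 := if_neg one_ne_zero

theorem zmodSign_add (a b : ZMod 2) : zmodSign (a + b) = zmodSign a * zmodSign b := by
  rcases ZMod.two_cases a with rfl | rfl <;> rcases ZMod.two_cases b with rfl | rfl <;>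
    simp [zmodSign_zero, zmodSign_one, ZMod.two_add_self]

theorem zmodSign_mul_self (a : ZMod 2) : zmodSign a * zmodSign a = 1 := by
  rw [← zmodSign_add, ZMod.two_add_self, zmodSign_zero]

theorem star_zmodSign (a : ZMod 2) : star (zmodSign a) = zmodSign a := by
  rcases ZMod.two_cases a with rfl | rfl <;> simp [zmodSign_zero, zmodSign_one]

theorem norm_zmodSign (a : ZMod 2) : ‖zmodSign a‖ = 1 := by
  rcases ZMod.two_cases a with rfl | rfl <;> simp [zmodSign_zero, zmodSign_one]

section Pauli

variable {ι : Type*}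

theorem Config.add_self (s : Config ι) : s + s = 0 := by
  ext i
  exact ZMod.two_add_self _

theorem Config.eq_add_iff {s t c : Config ι} : s = t + c ↔ t = s + c := by
  constructor <;> rintro rfl <;> rw [add_assoc, Config.add_self, add_zero]

theorem glue_add (X Y : Set ι) (a a' : Config X) (b b' : Config Y) (c c' : Config ↥((X ∪ Y)ᶜ)) :
    glue X Y (a + a') (b + b') (c + c') = glue X Y a b c + glue X Y a' b' c' := by
  ext i
  simp only [glue, Pi.add_apply]
  split_ifs <;> rfl

variable [Fintype ι]

theorem pauliX_mulVec (c : ι → ZMod 2) (φ : Config ι → ℂ) (s : Config ι) :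
    (pauliX c *ᵥ φ) s = φ (s + c) := by
  simp only [Matrix.mulVec, dotProduct, pauliX, Matrix.of_apply, ite_mul, one_mul, zero_mul]
  simp only [Config.eq_add_iff (s := s)]
  simp

theorem pauliZ_mulVec (c : ι → ZMod 2) (φ : Config ι → ℂ) (s : Config ι) :
    (pauliZ c *ᵥ φ) s = zmodSign (c ⬝ᵥ s) * φ s := by
  rw [pauliZ, Matrix.mulVec_diagonal]
  rfl

theorem pauliZProj_mulVec (c : ι → ZMod 2) (φ : Config ι → ℂ) (s : Config ι) :
    (pauliZProj c *ᵥ φ) s = if c ⬝ᵥ s = 0 then φ s else 0 := by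
  rw [pauliZProj, Matrix.smul_mulVec, Matrix.add_mulVec, Matrix.one_mulVec, Pi.smul_apply,
    Pi.add_apply, pauliZ_mulVec, zmodSign, smul_eq_mul]
  split_ifs <;> ring

theorem noncommProd_pauliZProj_mulVec {κ : Type*} (f : κ → ι → ZMod 2) (t : Finset κ) (h)
    (φ : Config ι → ℂ) (s : Config ι) :
    (t.noncommProd (fun k => pauliZProj (f k)) h *ᵥ φ) s
      = if ∀ k ∈ t, f k ⬝ᵥ s = 0 then φ s else 0 := by
  induction t using Finset.induction_on with
  | empty => simp
  | insert k t hk ih =>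
    rw [Finset.noncommProd_insert_of_notMem _ _ _ _ hk, ← Matrix.mulVec_mulVec,
      pauliZProj_mulVec, ih]
    simp only [Finset.forall_mem_insert]
    split_ifs <;> tauto

theorem normSq_pauliX_mulVec (c : ι → ZMod 2) (φ : Config ι → ℂ) :
    normSq (pauliX c *ᵥ φ) = normSq φ := by
  simp only [normSq, pauliX_mulVec]
  exact Equiv.sum_comp (Equiv.addRight c) fun s => ‖φ s‖ ^ 2

theorem normSq_pauliZ_mulVec (c : ι → ZMod 2) (φ : Config ι → ℂ) :
    normSq (pauliZ c *ᵥ φ) = normSq φ := by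
  simp only [normSq, pauliZ_mulVec, norm_mul, norm_zmodSign, one_mul]

theorem normSq_smul (a : ℂ) (φ : Config ι → ℂ) : normSq (a • φ) = ‖a‖ ^ 2 * normSq φ := by
  simp only [normSq, Pi.smul_apply, smul_eq_mul, norm_mul, mul_pow, Finset.mul_sum]

theorem normSq_nonneg (φ : Config ι → ℂ) : 0 ≤ normSq φ :=
  Finset.sum_nonneg fun _ _ => by positivity

theorem normSq_eq_zero_iff {φ : Config ι → ℂ} : normSq φ = 0 ↔ φ = 0 := by
  rw [normSq, Finset.sum_eq_zero_iff_of_nonneg fun _ _ => by positivity]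
  simp [funext_iff]

theorem normSq_eq_dotProduct (φ : Config ι → ℂ) : (normSq φ : ℂ) = star φ ⬝ᵥ φ := by
  simp only [normSq, dotProduct, Pi.star_apply, Complex.ofReal_sum]
  refine Finset.sum_congr rfl fun s _ => ?_
  rw [Complex.star_def, Complex.conj_mul']
  push_cast
  rfl

theorem normSq_sub (φ χ : Config ι → ℂ) :
    normSq (φ - χ) = normSq φ + normSq χ - 2 * (star φ ⬝ᵥ χ).re := by
  have h : (normSq (φ - χ) : ℂ) = star φ ⬝ᵥ φ + star χ ⬝ᵥ χ - (star φ ⬝ᵥ χ + star χ ⬝ᵥ φ) := by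
    rw [normSq_eq_dotProduct, star_sub, sub_dotProduct, dotProduct_sub, dotProduct_sub]
    ring
  have h' : star χ ⬝ᵥ φ = star (star φ ⬝ᵥ χ) := by
    rw [Matrix.star_dotProduct, dotProduct_comm]
  have := congrArg Complex.re h
  rw [h', ← normSq_eq_dotProduct, ← normSq_eq_dotProduct] at this
  simp only [Complex.ofReal_re, Complex.sub_re, Complex.add_re, Complex.star_def,
    Complex.conj_re] at this
  rw [this]
  ring

/-! ## Reduced density matrices -/

/-- The restrictions of a configuration to disjoint sets `X`, `Y` and the rest determine it. -/
def glueEquiv (X Y : Set ι) (h : Disjoint X Y) :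
    (Config X × Config Y) × Config ↥((X ∪ Y)ᶜ) ≃ Config ι where
  toFun q := glue X Y q.1.1 q.1.2 q.2
  invFun s := ((fun i => s i, fun i => s i), fun i => s i)
  left_inv q := by
    obtain ⟨⟨a, b⟩, c⟩ := q
    refine Prod.ext (Prod.ext ?_ ?_) ?_
    · ext ⟨i, hi⟩
      simp [glue, hi]
    · ext ⟨i, hi⟩
      simp [glue, hi, Set.disjoint_right.mp h hi]
    · ext ⟨i, hi⟩
      have h1 : i ∉ X := fun hX => hi (Or.inl hX)
      have h2 : i ∉ Y := fun hY => hi (Or.inr hY)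
      simp [glue, h1, h2]
  right_inv s := by
    ext i
    simp only [glue]
    split_ifs <;> rfl

theorem sum_glue {A : Type*} [AddCommMonoid A] {X Y : Set ι} (h : Disjoint X Y)
    (F : Config ι → A) : ∑ p : Config X × Config Y, ∑ c, F (glue X Y p.1 p.2 c) = ∑ s, F s := by
  rw [← (glueEquiv X Y h).sum_comp]
  exact (Fintype.sum_prod_type fun q => F (glueEquiv X Y h q)).symm

theorem reduced_densityMatrix_apply (φ : Config ι → ℂ) (X Y : Set ι) (p q) :
    reduced (densityMatrix φ) X Y p q
      = ∑ c, φ (glue X Y p.1 p.2 c) * star (φ (glue X Y q.1 q.2 c)) := rfl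

theorem trace_reduced_densityMatrix (φ : Config ι → ℂ) {X Y : Set ι} (h : Disjoint X Y) :
    (reduced (densityMatrix φ) X Y).trace = normSq φ := by
  simp only [Matrix.trace, Matrix.diag_apply, reduced_densityMatrix_apply]
  rw [sum_glue h (fun s => φ s * star (φ s)), normSq_eq_dotProduct, dotProduct]
  exact Finset.sum_congr rfl fun s _ => mul_comm _ _

theorem posSemidef_reduced_densityMatrix (φ : Config ι → ℂ) (X Y : Set ι) :
    (reduced (densityMatrix φ) X Y).PosSemidef := by
  have : reduced (densityMatrix φ) X Y = ∑ c, Matrix.vecMulVec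
      (fun p : Config X × Config Y => φ (glue X Y p.1 p.2 c))
      (star fun p : Config X × Config Y => φ (glue X Y p.1 p.2 c)) := by
    ext p q
    rw [reduced_densityMatrix_apply, Matrix.sum_apply]
    rfl
  rw [this]
  exact Matrix.posSemidef_sum _ fun c _ => Matrix.posSemidef_vecMulVec_self_star _

/-- If `φ` transforms with a sign under translations by a subspace `K`, is supported on one coset
of `K`, and `K` splits along `X` and `Y`, then the reduced density matrix is a product. -/
theorem reduced_mul_reduced {φ : Config ι → ℂ} {X Y : Set ι} (K : AddSubgroup (Config ι))
    (w : Config ι) (hcov : ∀ u ∈ K, ∀ s, φ (s + u) = zmodSign (w ⬝ᵥ u) * φ s)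
    (hsupp : ∀ s t, φ s ≠ 0 → φ t ≠ 0 → s + t ∈ K)
    (hcut : ∀ a b, glue X Y a b 0 ∈ K → glue X Y a 0 0 ∈ K)
    (hlift : ∀ a b c, glue X Y a b c ∈ K → ∃ c', glue X Y a 0 c' ∈ K)
    (a a' α α' : Config X) (b b' β β' : Config Y) :
    reduced (densityMatrix φ) X Y (a, b) (a', b') * reduced (densityMatrix φ) X Y (α, β) (α', β')
      = reduced (densityMatrix φ) X Y (a, β) (a', β')
        * reduced (densityMatrix φ) X Y (α, b) (α', b') := by
  set R : Config X → Config Y → Config X → Config Y → ℂ :=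
    fun a b a' b' => reduced (densityMatrix φ) X Y (a, b) (a', b') with hR
  have hRdef : ∀ a b a' b',
      R a b a' b' = ∑ c, φ (glue X Y a b c) * star (φ (glue X Y a' b' c)) := fun _ _ _ _ => rfl
  have hne : ∀ a b a' b', R a b a' b' ≠ 0 →
      ∃ c, φ (glue X Y a b c) ≠ 0 ∧ φ (glue X Y a' b' c) ≠ 0 := by
    intro a b a' b' h
    obtain ⟨c, -, hc⟩ := Finset.exists_ne_zero_of_sum_ne_zero (hRdef a b a' b' ▸ h)
    exact ⟨c, left_ne_zero_of_mul hc, fun h0 => right_ne_zero_of_mul hc (by rw [h0, star_zero])⟩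
  -- Translating a single index by an element of `K` supported on `X` costs only a sign.
  have hright : ∀ a a' b b', glue X Y (a + a') 0 0 ∈ K →
      R a b a' b' = zmodSign (w ⬝ᵥ glue X Y (a + a') 0 0) * R a b a b' := by
    intro a a' b b' h
    rw [hRdef, hRdef, Finset.mul_sum]
    refine Finset.sum_congr rfl fun c _ => ?_
    have e : glue X Y a' b' c = glue X Y a b' c + glue X Y (a + a') 0 0 := by
      rw [← glue_add, ← add_assoc, Config.add_self, zero_add, add_zero, add_zero]
    rw [e, hcov _ h, star_mul', star_zmodSign]
    ring
  -- Translating both indices cancels the signs, and the shift `δ` of the traced-out qubits is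
  -- absorbed into the sum.
  have hshift : ∀ a α b b' δ, glue X Y (a + α) 0 δ ∈ K → R a b a b' = R α b α b' := by
    intro a α b b' δ h
    rw [hRdef, hRdef, ← Equiv.sum_comp (Equiv.addRight δ)]
    refine Finset.sum_congr rfl fun c _ => ?_
    have e : ∀ b, glue X Y a b (c + δ) = glue X Y α b c + glue X Y (a + α) 0 δ := fun b => by
      rw [← glue_add, add_comm a, ← add_assoc, Config.add_self, zero_add, add_zero]
    rw [Equiv.coe_addRight, e, e, hcov _ h, hcov _ h, star_mul', star_zmodSign]
    linear_combination (φ (glue X Y α b c) * star (φ (glue X Y α b' c)))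
      * zmodSign_mul_self (w ⬝ᵥ glue X Y (a + α) 0 δ)
  have main : ∀ b b' β β', R a b a' b' * R α β α' β' ≠ 0 →
      R a b a' b' * R α β α' β' = R a β a' β' * R α b α' b' := by
    intro b b' β β' h
    obtain ⟨c, hc, hc'⟩ := hne _ _ _ _ (left_ne_zero_of_mul h)
    obtain ⟨γ, hγ, hγ'⟩ := hne _ _ _ _ (right_ne_zero_of_mul h)
    have h1 : glue X Y (a + a') 0 0 ∈ K := hcut _ (b + b') (by
      have := hsupp _ _ hc hc'
      rwa [← glue_add, Config.add_self] at this)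
    have h2 : glue X Y (α + α') 0 0 ∈ K := hcut _ (β + β') (by
      have := hsupp _ _ hγ hγ'
      rwa [← glue_add, Config.add_self] at this)
    obtain ⟨δ, hδ⟩ := hlift (a + α) (b + β) (c + γ) (by
      have := hsupp _ _ hc hγ
      rwa [← glue_add] at this)
    rw [hright a a' b b' h1, hright a a' β β' h1, hright α α' b b' h2, hright α α' β β' h2,
      hshift a α b b' δ hδ, hshift a α β β' δ hδ]
    ring
  change R a b a' b' * R α β α' β' = R a β a' β' * R α b α' b'
  -- `main` needs a nonzero left side to produce elements of `K`. If the left side vanishes but the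
  -- right side does not, it is applied with the `Y` indices exchanged.
  by_cases h : R a b a' b' * R α β α' β' = 0
  · by_contra hc
    rw [h] at hc
    exact hc (h ▸ (main β β' b b' (Ne.symm hc)).symm)
  · exact main b b' β β' h

/-- If the cross terms are traced out, a superposition reduces to a mixture. -/
theorem reduced_densityMatrix_sum {κ : Type*} [Fintype κ] (X Y : Set ι) (c : κ → ℂ)
    (φ : κ → Config ι → ℂ) (hoff : ∀ i j, i ≠ j → ∀ (a a' : Config X) (b b' : Config Y),
      ∑ γ, φ i (glue X Y a b γ) * star (φ j (glue X Y a' b' γ)) = 0) :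
    reduced (densityMatrix (∑ i, c i • φ i)) X Y
      = ∑ i, ((‖c i‖ ^ 2 : ℝ) : ℂ) • reduced (densityMatrix (φ i)) X Y := by
  ext ⟨a, b⟩ ⟨a', b'⟩
  simp only [Matrix.sum_apply, Matrix.smul_apply, reduced_densityMatrix_apply, Finset.sum_apply,
    Pi.smul_apply, smul_eq_mul, star_sum, star_mul', Finset.sum_mul_sum]
  rw [Finset.sum_comm]
  refine Finset.sum_congr rfl fun i _ => ?_
  rw [Finset.sum_comm, Finset.sum_eq_single i]
  · rw [Complex.ofReal_pow, ← Complex.mul_conj', Finset.mul_sum]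
    refine Finset.sum_congr rfl fun γ _ => ?_
    rw [Complex.star_def]
    ring
  · intro j _ hj
    have := congrArg (fun t => c i * star (c j) * t) (hoff i j hj.symm a a' b b')
    simp only [Finset.mul_sum, mul_zero] at this
    rw [← this]
    exact Finset.sum_congr rfl fun γ _ => by ring
  · simp

theorem reduced_eq_kronecker {φ : Config ι → ℂ} {X Y : Set ι} (hXY : Disjoint X Y)
    (hφ : normSq φ = 1) (hmul : ∀ (a a' α α' : Config X) (b b' β β' : Config Y),
      reduced (densityMatrix φ) X Y (a, b) (a', b') * reduced (densityMatrix φ) X Y (α, β) (α', β')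
        = reduced (densityMatrix φ) X Y (a, β) (a', β')
          * reduced (densityMatrix φ) X Y (α, b) (α', b')) :
    reduced (densityMatrix φ) X Y
      = traceRight (reduced (densityMatrix φ) X Y) ⊗ₖ traceLeft (reduced (densityMatrix φ) X Y) := by
  have htr := trace_reduced_densityMatrix φ hXY
  ext ⟨a, b⟩ ⟨a', b'⟩
  rw [Matrix.kronecker_apply, ← mul_one (reduced _ _ _ _ _)]
  -- Inserting the trace as a factor one allows the exchange identity to be summed over a diagonal
  -- second entry, which produces the two partial traces.
  have h1 : (1 : ℂ) = ∑ α, ∑ β, reduced (densityMatrix φ) X Y (α, β) (α, β) := by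
    rw [← Fintype.sum_prod_type', ← Complex.ofReal_one, ← hφ, ← htr]
    rfl
  rw [h1]
  simp only [traceRight, traceLeft, Matrix.of_apply, Finset.mul_sum, Finset.sum_mul]
  exact Finset.sum_congr rfl fun α _ => Finset.sum_congr rfl fun β _ => hmul _ _ _ _ _ _ _ _

end Pauli

/-! ## Bipartite states -/

section Bipartite

variable {m n : Type*} [Fintype m] [Fintype n]

theorem trace_traceRight (ρ : Matrix (m × n) (m × n) ℂ) : (traceRight ρ).trace = ρ.trace := by
  simp only [Matrix.trace, Matrix.diag_apply, traceRight, Matrix.of_apply]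
  exact (Fintype.sum_prod_type fun p : m × n => ρ p p).symm

theorem trace_traceLeft (ρ : Matrix (m × n) (m × n) ℂ) : (traceLeft ρ).trace = ρ.trace := by
  simp only [Matrix.trace, Matrix.diag_apply, traceLeft, Matrix.of_apply]
  exact (Fintype.sum_prod_type_right fun p : m × n => ρ p p).symm

theorem IsDensity.traceRight {ρ : Matrix (m × n) (m × n) ℂ} (h : IsDensity ρ) :
    IsDensity (traceRight ρ) := by
  refine ⟨?_, by rw [trace_traceRight, h.2]⟩
  have : _root_.traceRight ρ = ∑ j, ρ.submatrix (fun i => (i, j)) (fun i => (i, j)) := by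
    ext i k
    rw [Matrix.sum_apply]
    rfl
  rw [this]
  exact Matrix.posSemidef_sum _ fun j _ => h.1.submatrix _

theorem IsDensity.traceLeft {ρ : Matrix (m × n) (m × n) ℂ} (h : IsDensity ρ) :
    IsDensity (traceLeft ρ) := by
  refine ⟨?_, by rw [trace_traceLeft, h.2]⟩
  have : _root_.traceLeft ρ = ∑ j, ρ.submatrix (fun i => (j, i)) (fun i => (j, i)) := by
    ext i k
    rw [Matrix.sum_apply]
    rfl
  rw [this]
  exact Matrix.posSemidef_sum _ fun j _ => h.1.submatrix _

/-- Separable states have positive partial transpose, hence no logarithmic negativity. -/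
theorem IsSeparableState.logNegativity_eq_zero {ρ : Matrix (m × n) (m × n) ℂ}
    (h : IsSeparableState ρ) : logNegativity ρ = 0 := by
  obtain ⟨N, p, α, β, hp, hsum, hα, hβ, rfl⟩ := h
  have hpt : partialTranspose (∑ i, (p i : ℂ) • (α i ⊗ₖ β i))
      = ∑ i, (p i : ℂ) • ((α i)ᵀ ⊗ₖ β i) := by
    ext q r
    simp [partialTranspose, Matrix.sum_apply, Matrix.kroneckerMap_apply]
  have hpos : (∑ i, (p i : ℂ) • ((α i)ᵀ ⊗ₖ β i)).PosSemidef :=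
    Matrix.posSemidef_sum _ fun i _ =>
      ((hα i).1.transpose.kronecker (hβ i).1).smul (by exact_mod_cast hp i)
  rw [logNegativity, hpt, CFC.abs_of_nonneg _ (Matrix.nonneg_iff_posSemidef.mpr hpos)]
  have : (∑ i, (p i : ℂ) • ((α i)ᵀ ⊗ₖ β i)).trace = 1 := by
    rw [Matrix.trace_sum]
    simp only [Matrix.trace_smul, Matrix.trace_kronecker, Matrix.trace_transpose, (hα _).2,
      (hβ _).2, mul_one, smul_eq_mul]
    exact_mod_cast hsum
  rw [this, Complex.one_re, Real.logb_one]

end Bipartite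

/-! ## Cleaning loops -/

namespace FluxLoops

open TorusLattice

variable {D : Type*} [Fintype D] {M : TorusLattice D}

/-- The chains supported on a region. -/
def supportedSubmodule (R : Set M.Edge) : Submodule (ZMod 2) (M.Edge → ZMod 2) where
  carrier := {c | M.SupportedOn R c}
  zero_mem' e he := absurd rfl he
  add_mem' {a b} ha hb e he := by
    by_contra hR
    have h1 : a e = 0 := by by_contra h; exact hR (ha e h)
    have h2 : b e = 0 := by by_contra h; exact hR (hb e h)
    exact he (by rw [Pi.add_apply, h1, h2, add_zero])
  smul_mem' c a ha e he := ha e (right_ne_zero_of_mul he)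

/-- A chain can be moved into `R` by elements of `V` unless some chain supported off `R` and
orthogonal to `V` obstructs this. -/
theorem exists_clean (V : Submodule (ZMod 2) (M.Edge → ZMod 2)) (R : Set M.Edge)
    (y : M.Edge → ZMod 2)
    (h : ∀ w : M.Edge → ZMod 2, (∀ v ∈ V, w ⬝ᵥ v = 0) → M.SupportedOn Rᶜ w → w ⬝ᵥ y = 0) :
    ∃ r, M.SupportedOn R r ∧ y - r ∈ V := by
  -- The annihilator of a sum is the intersection of the annihilators, and being orthogonal to all
  -- chains on `R` means being supported off `R`.
  have : y ∈ V ⊔ supportedSubmodule R := by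
    refine Submodule.mem_of_forall_dotProduct_eq_zero _ _ fun w hw => h w
      (fun v hv => hw v (Submodule.mem_sup_left hv)) fun e he heR => he ?_
    have := hw (Pi.single e 1) (Submodule.mem_sup_right fun e' he' => by
      by_cases h : e' = e
      · rwa [h]
      · exact absurd (by simp [h]) he')
    rwa [dotProduct_single_one] at this
  obtain ⟨v, hv, r, hr, rfl⟩ := Submodule.mem_sup.mp this
  exact ⟨r, hr, by rwa [add_sub_cancel_right]⟩

theorem exists_dart_of_legs_ne_zero {v : M.Vertex} {e : M.Edge} (h : M.legs v e ≠ 0) :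
    ∃ d, M.vertexOf d = v ∧ M.edgeOf d = e := by
  by_contra hc
  refine h ?_
  rw [legs, Finset.filter_false_of_mem fun d _ hd => hc ⟨d, hd⟩]
  rfl

theorem exists_dart_of_boundary_ne_zero {p : M.Face} {e : M.Edge} (h : M.boundary p e ≠ 0) :
    ∃ d, M.faceOf d = p ∧ M.edgeOf d = e := by
  by_contra hc
  refine h ?_
  rw [boundary, Finset.filter_false_of_mem fun d _ hd => hc ⟨d, hd⟩]
  rfl

/-- If `f` meets `X` it misses `Y`, so it sees only the `X` part of `w`; otherwise it does not see
that part at all. -/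
theorem dotProduct_indicator_eq_zero {ι : Type*} [Fintype ι] {X Y : Set ι} {f w : ι → ZMod 2}
    (hw : ∀ e, w e ≠ 0 → e ∈ X ∪ Y) (hf : ∀ e e', e ∈ X → e' ∈ Y → f e ≠ 0 → f e' = 0)
    (h : f ⬝ᵥ w = 0) : f ⬝ᵥ X.indicator w = 0 := by
  by_cases hX : ∃ e ∈ X, f e ≠ 0
  · obtain ⟨e, he, hfe⟩ := hX
    rw [← h]
    refine Finset.sum_congr rfl fun e' _ => ?_
    by_cases h' : e' ∈ X
    · rw [Set.indicator_of_mem h']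
    · rw [Set.indicator_of_notMem h']
      by_cases hwe : w e' = 0
      · rw [hwe]
      · rw [hf e e' he ((hw e' hwe).resolve_left h') hfe, zero_mul, zero_mul]
  · push Not at hX
    refine Finset.sum_eq_zero fun e _ => ?_
    by_cases he : e ∈ X
    · rw [hX e he, zero_mul]
    · rw [Set.indicator_of_notMem he, mul_zero]

theorem Apart.isDualLoop_indicator {X Y : Set M.Edge} (hXY : Apart M X Y) {w : M.Edge → ZMod 2}
    (hw : M.IsDualLoop w) (hs : M.SupportedOn (X ∪ Y) w) : M.IsDualLoop (X.indicator w) :=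
  fun p => dotProduct_indicator_eq_zero hs (fun e e' he he' h => by
    by_contra h'
    obtain ⟨d, hd, rfl⟩ := exists_dart_of_boundary_ne_zero h
    obtain ⟨d', hd', rfl⟩ := exists_dart_of_boundary_ne_zero h'
    exact hXY d d' (Or.inr (hd.trans hd'.symm)) ⟨he, he'⟩) (hw p)

theorem Apart.isLoop_indicator {X Y : Set M.Edge} (hXY : Apart M X Y) {w : M.Edge → ZMod 2}
    (hw : M.IsLoop w) (hs : M.SupportedOn (X ∪ Y) w) : M.IsLoop (X.indicator w) :=
  fun p => dotProduct_indicator_eq_zero hs (fun e e' he he' h => by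
    by_contra h'
    obtain ⟨d, hd, rfl⟩ := exists_dart_of_legs_ne_zero h
    obtain ⟨d', hd', rfl⟩ := exists_dart_of_legs_ne_zero h'
    exact hXY d d' (Or.inl (hd.trans hd'.symm)) ⟨he, he'⟩) (hw p)

theorem supportedOn_indicator (X : Set M.Edge) (w : M.Edge → ZMod 2) :
    M.SupportedOn X (X.indicator w) := fun _ h => Set.mem_of_indicator_ne_zero h

theorem eq_indicator_add_indicator {X Y : Set M.Edge} (hXY : Disjoint X Y)
    {w : M.Edge → ZMod 2} (hs : M.SupportedOn (X ∪ Y) w) :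
    w = X.indicator w + Y.indicator w := by
  exact (Set.indicator_eq_self.mpr fun e he => hs e he).symm.trans
    (Set.indicator_union_of_disjoint hXY w)

variable (W : FluxLoops M)

/-- An obstruction would be a dual loop on `X ∪ Y` crossing `z₁` oddly. It splits into dual loops in
`X` and in `Y`, and both cross `z₁` evenly. -/
theorem exists_z₁_off {X Y : Set M.Edge} (hXY : Apart M X Y) (hX : W.OnlyDirectionOne X)
    (hY : W.OnlyDirectionOne Y) :
    ∃ z, M.SupportedOn (X ∪ Y)ᶜ z ∧ M.IsTrivial (W.z₁ - z) := by
  refine exists_clean _ _ _ fun w hw hs => ?_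
  rw [compl_compl] at hs
  have hloop : M.IsDualLoop w := fun p => by
    rw [dotProduct_comm]
    exact hw _ (Submodule.subset_span ⟨p, rfl⟩)
  rw [eq_indicator_add_indicator hXY.disjoint hs, add_dotProduct, dotProduct_comm,
    hX.1 _ (hXY.isDualLoop_indicator hloop hs) (supportedOn_indicator X w), dotProduct_comm,
    hY.1 _ (hXY.symm.isDualLoop_indicator hloop (by rwa [Set.union_comm]))
      (supportedOn_indicator Y w), add_zero]

theorem exists_x₁_off {X Y : Set M.Edge} (hXY : Apart M X Y) (hX : W.OnlyDirectionOne X)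
    (hY : W.OnlyDirectionOne Y) :
    ∃ x, M.SupportedOn (X ∪ Y)ᶜ x ∧ M.IsDualTrivial (W.x₁ - x) := by
  refine exists_clean _ _ _ fun w hw hs => ?_
  rw [compl_compl] at hs
  have hloop : M.IsLoop w := fun p => by
    rw [dotProduct_comm]
    exact hw _ (Submodule.subset_span ⟨p, rfl⟩)
  rw [eq_indicator_add_indicator hXY.disjoint hs, add_dotProduct, dotProduct_comm,
    hX.2 _ (hXY.isLoop_indicator hloop hs) (supportedOn_indicator X w), dotProduct_comm,
    hY.2 _ (hXY.symm.isLoop_indicator hloop (by rwa [Set.union_comm]))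
      (supportedOn_indicator Y w), add_zero]

/-- The dual loops that cross `z₁` an even number of times. -/
def evenDualLoops : Submodule (ZMod 2) (M.Edge → ZMod 2) where
  carrier := {u | M.IsDualLoop u ∧ W.z₁ ⬝ᵥ u = 0}
  zero_mem' := ⟨fun _ => dotProduct_zero _, dotProduct_zero _⟩
  add_mem' ha hb := ⟨ha.1.add hb.1, by rw [dotProduct_add, ha.2, hb.2, add_zero]⟩
  smul_mem' c _ ha := ⟨ha.1.smul c, by rw [dotProduct_smul, ha.2, smul_zero]⟩

/-- Even dual loops are generated by stars and `x₁`, and `z` is orthogonal to both. -/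
theorem dotProduct_evenDualLoop {z u : M.Edge → ZMod 2} (hz : M.IsLoop z) (h : W.x₁ ⬝ᵥ z = 0)
    (hu : u ∈ W.evenDualLoops) : z ⬝ᵥ u = 0 := by
  by_cases ht : M.IsDualTrivial u
  · exact hz.dotProduct_dualTrivial ht
  · have := hz.dotProduct_dualTrivial (W.isDualTrivial_x₁_sub hu.1 hu.2 ht)
    rwa [dotProduct_sub, dotProduct_comm, h, zero_sub, neg_eq_zero] at this

theorem glue_mem_evenDualLoops_of_glue {X Y : Set M.Edge} (hXY : Apart M X Y)
    (hX : W.OnlyDirectionOne X) (a : Config X) (b : Config Y)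
    (h : glue X Y a b 0 ∈ W.evenDualLoops) : glue X Y a 0 0 ∈ W.evenDualLoops := by
  have hs : M.SupportedOn (X ∪ Y) (glue X Y a b 0) := fun e he => by
    by_contra hc
    rw [Set.mem_union, not_or] at hc
    exact he (by simp [glue, hc.1, hc.2])
  have heq : glue X Y a 0 0 = X.indicator (glue X Y a b 0) := by
    ext e
    by_cases he : e ∈ X <;> simp [glue, he]
  rw [heq]
  have := hXY.isDualLoop_indicator h.1 hs
  exact ⟨this, hX.1 _ this (supportedOn_indicator _ _)⟩

/-- The `X` part is moved into the group by a correction off `X ∪ Y`. A chain `w` obstructing this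
would be a loop on `X ∪ Y`; its `X` part has direction `1` or is contractible, so it is orthogonal
to the given group element and hence `w` is orthogonal to the `X` part. -/
theorem exists_glue_mem_evenDualLoops {X Y : Set M.Edge} (hXY : Apart M X Y)
    (hX : W.OnlyDirectionOne X) (a : Config X) (b : Config Y) (c)
    (h : glue X Y a b c ∈ W.evenDualLoops) : ∃ c', glue X Y a 0 c' ∈ W.evenDualLoops := by
  obtain ⟨r, hr, hmem⟩ := exists_clean W.evenDualLoops (X ∪ Y)ᶜ (glue X Y a 0 0) fun w hw hs => by
    rw [compl_compl] at hs
    have hloop : M.IsLoop w := fun v => by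
      have ht : M.IsDualTrivial (M.legs v) := Submodule.subset_span ⟨v, rfl⟩
      rw [dotProduct_comm]
      exact hw _ ⟨ht.isDualLoop, W.loop₁.dotProduct_dualTrivial ht⟩
    have hl := hXY.isLoop_indicator hloop hs
    have h0 := W.dotProduct_evenDualLoop hl (hX.2 _ hl (supportedOn_indicator X w)) h
    rw [← h0]
    refine Finset.sum_congr rfl fun e _ => ?_
    by_cases he : e ∈ X <;> simp [glue, he]
  refine ⟨fun e => (glue X Y a 0 0 - r) e, ?_⟩
  have hr0 : ∀ e, e ∈ X ∪ Y → r e = 0 := fun e he => by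
    by_contra hc
    exact hr e hc he
  convert hmem using 1
  ext e
  by_cases h1 : e ∈ X
  · simp [glue, h1, hr0 e (Or.inl h1)]
  · by_cases h2 : e ∈ Y
    · simp [glue, h1, h2, hr0 e (Or.inr h2)]
    · simp [glue, h1, h2]

/-! ## Flux states -/

theorem pauliX_pow {ι : Type*} [Fintype ι] (c : ι → ZMod 2) (k : ℕ) :
    pauliX c ^ k = pauliX ((k : ZMod 2) • c) := by
  induction k with
  | zero => simp [pauliX_zero]
  | succ k ih => rw [pow_succ, ih, ← pauliX_add, Nat.cast_succ, add_smul, one_smul]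

theorem pauliZ_pow {ι : Type*} [Fintype ι] (c : ι → ZMod 2) (k : ℕ) :
    pauliZ c ^ k = pauliZ ((k : ZMod 2) • c) := by
  induction k with
  | zero => simp [pauliZ_zero]
  | succ k ih => rw [pow_succ, ih, ← pauliZ_add, Nat.cast_succ, add_smul, one_smul]

theorem unnormalized_apply (s : Config M.Edge) :
    W.unnormalized s = if M.IsDualLoop s ∧ W.z₁ ⬝ᵥ s = 0 then plusState s else 0 := by
  rw [unnormalized, ← Matrix.mulVec_mulVec, noncommProd_pauliZProj_mulVec, pauliZProj_mulVec]
  simp only [Finset.mem_univ, true_imp_iff, ite_and]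
  exact if_congr Iff.rfl rfl rfl

theorem plusState_ne_zero {ι : Type*} [Fintype ι] (s : Config ι) : plusState s ≠ 0 := by
  rw [plusState, Complex.ofReal_ne_zero]
  positivity

theorem normSq_unnormalized_pos : 0 < normSq W.unnormalized := by
  refine lt_of_le_of_ne (normSq_nonneg _) fun h => ?_
  have := congrFun (normSq_eq_zero_iff.mp h.symm) 0
  rw [unnormalized_apply, if_pos ⟨fun _ => dotProduct_zero _, dotProduct_zero _⟩] at this
  exact plusState_ne_zero _ this

theorem normSq_psiI : normSq W.psiI = 1 := by
  have h := W.normSq_unnormalized_pos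
  rw [psiI, normSq_smul, Complex.norm_real, Real.norm_eq_abs, sq_abs, div_pow, one_pow,
    Real.sq_sqrt h.le, one_div, inv_mul_cancel₀ h.ne']

theorem normSq_psi (k l : Fin 2) : normSq (W.psi k l) = 1 := by
  rw [psi, ← Matrix.mulVec_mulVec, pauliX_pow, pauliZ_pow, normSq_pauliX_mulVec,
    normSq_pauliZ_mulVec, normSq_psiI]

/-- Shifting by `x₂` changes the crossing parity with `z₁` and keeps that with `z₂`. Thus `k`
selects the support and `l` a character, while `N` is common to the four states. -/
theorem exists_psi_apply : ∃ N : ℂ, N ≠ 0 ∧ ∀ (k l : Fin 2) (s : Config M.Edge), W.psi k l s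
    = if M.IsDualLoop s ∧ W.z₁ ⬝ᵥ s = ((k : ℕ) : ZMod 2) then
        N * zmodSign (((l : ℕ) : ZMod 2) * (W.z₂ ⬝ᵥ s)) else 0 := by
  have hpos := W.normSq_unnormalized_pos
  refine ⟨((1 / Real.sqrt (normSq W.unnormalized) : ℝ) : ℂ) * plusState (0 : Config M.Edge),
    mul_ne_zero ?_ (plusState_ne_zero _), fun k l s => ?_⟩
  · rw [Complex.ofReal_ne_zero]
    positivity
  · have h1 : M.IsDualLoop (s + ((k : ℕ) : ZMod 2) • W.x₂) ↔ M.IsDualLoop s := by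
      refine ⟨fun h => ?_, fun h => h.add (W.dual₂.smul _)⟩
      have := h.sub (W.dual₂.smul ((k : ℕ) : ZMod 2))
      rwa [add_sub_cancel_right] at this
    have h2 : W.z₁ ⬝ᵥ (s + ((k : ℕ) : ZMod 2) • W.x₂) = 0 ↔ W.z₁ ⬝ᵥ s = ((k : ℕ) : ZMod 2) := by
      rw [dotProduct_add, dotProduct_smul, W.cross₁₂, smul_eq_mul, mul_one, CharTwo.add_eq_zero]
    have h3 : W.z₂ ⬝ᵥ (s + ((k : ℕ) : ZMod 2) • W.x₂) = W.z₂ ⬝ᵥ s := by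
      rw [dotProduct_add, dotProduct_smul, W.cross₂₂, smul_zero, add_zero]
    rw [psi, ← Matrix.mulVec_mulVec, pauliX_pow, pauliZ_pow, pauliX_mulVec, pauliZ_mulVec, psiI,
      Pi.smul_apply, unnormalized_apply, smul_dotProduct, h3, smul_eq_mul, smul_eq_mul]
    simp only [h1, h2]
    split_ifs
    · rw [mul_comm]
      rfl
    · rw [mul_zero, mul_zero]

theorem psi_add {k l : Fin 2} {u : Config M.Edge} (hu : u ∈ W.evenDualLoops) (s : Config M.Edge) :
    W.psi k l (s + u) = zmodSign ((((l : ℕ) : ZMod 2) • W.z₂) ⬝ᵥ u) * W.psi k l s := by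
  obtain ⟨N, -, hN⟩ := W.exists_psi_apply
  have h1 : M.IsDualLoop (s + u) ↔ M.IsDualLoop s := by
    refine ⟨fun h => ?_, fun h => h.add hu.1⟩
    have := h.sub hu.1
    rwa [add_sub_cancel_right] at this
  rw [hN, hN, h1, dotProduct_add, hu.2, add_zero, dotProduct_add, mul_add, zmodSign_add,
    smul_dotProduct, smul_eq_mul]
  split_ifs <;> ring

theorem add_mem_of_psi_ne_zero {k l : Fin 2} {s t : Config M.Edge} (hs : W.psi k l s ≠ 0)
    (ht : W.psi k l t ≠ 0) : s + t ∈ W.evenDualLoops := by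
  obtain ⟨N, -, hN⟩ := W.exists_psi_apply
  rw [hN] at hs ht
  obtain ⟨h1, h2⟩ := (ite_ne_right_iff.mp hs).1
  obtain ⟨h3, h4⟩ := (ite_ne_right_iff.mp ht).1
  exact ⟨h1.add h3, by rw [dotProduct_add, h2, h4, ZMod.two_add_self]⟩

theorem reduced_psi {X Y : Set M.Edge} (hXY : Apart M X Y) (hX : W.OnlyDirectionOne X)
    (k l : Fin 2) :
    reduced (densityMatrix (W.psi k l)) X Y
      = traceRight (reduced (densityMatrix (W.psi k l)) X Y)
        ⊗ₖ traceLeft (reduced (densityMatrix (W.psi k l)) X Y) :=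
  reduced_eq_kronecker hXY.disjoint (W.normSq_psi k l) fun a a' α α' b b' β β' =>
    reduced_mul_reduced W.evenDualLoops.toAddSubgroup _ (fun _ hu s => W.psi_add hu s)
      (fun _ _ => W.add_mem_of_psi_ne_zero) (W.glue_mem_evenDualLoops_of_glue hXY hX)
      (W.exists_glue_mem_evenDualLoops hXY hX) a a' α α' b b' β β'

theorem dotProduct_glue_of_supportedOn {X Y : Set M.Edge} {z : M.Edge → ZMod 2}
    (hz : M.SupportedOn (X ∪ Y)ᶜ z) (a a' : Config X) (b b' : Config Y) (c) :
    z ⬝ᵥ glue X Y a b c = z ⬝ᵥ glue X Y a' b' c := by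
  refine Finset.sum_congr rfl fun e _ => ?_
  by_cases he : z e = 0
  · rw [he, zero_mul, zero_mul]
  · have := hz e he
    rw [Set.mem_compl_iff, Set.mem_union, not_or] at this
    simp [glue, this.1, this.2]

theorem cast_fin_two_injective {k k' : Fin 2} (h : ((k : ℕ) : ZMod 2) = ((k' : ℕ) : ZMod 2)) :
    k = k' := by
  revert k k'
  decide

/-- States of different flux through `X` and `Y` are distinguished by loops off `X` and `Y`. -/
theorem sum_psi_mul_star_psi {X Y : Set M.Edge} (hXY : Apart M X Y) (hX : W.OnlyDirectionOne X)
    (hY : W.OnlyDirectionOne Y) {k l k' l' : Fin 2} (hne : (k, l) ≠ (k', l'))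
    (a a' : Config X) (b b' : Config Y) :
    ∑ c, W.psi k l (glue X Y a b c) * star (W.psi k' l' (glue X Y a' b' c)) = 0 := by
  obtain ⟨N, -, hN⟩ := W.exists_psi_apply
  by_cases hk : k = k'
  -- For fluxes differing in `l`, translating the traced-out qubits by a copy of `x₁` off both
  -- regions reverses the sign of the sum.
  · have hl : l ≠ l' := fun h => hne (by rw [hk, h])
    obtain ⟨x, hx, ht⟩ := W.exists_x₁_off hXY hX hY
    have hxd : M.IsDualLoop x := by
      have := W.dual₁.sub ht.isDualLoop
      rwa [sub_sub_cancel] at this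
    have hz₁ : W.z₁ ⬝ᵥ x = 0 := by
      have := W.loop₁.dotProduct_dualTrivial ht
      rwa [dotProduct_sub, W.cross₁₁, zero_sub, neg_eq_zero] at this
    have hz₂ : W.z₂ ⬝ᵥ x = 1 := by
      have := W.loop₂.dotProduct_dualTrivial ht
      rw [dotProduct_sub, W.cross₂₁, sub_eq_zero] at this
      exact this.symm
    let r : Config ↥((X ∪ Y)ᶜ) := fun e => x e
    have hglue : glue X Y 0 0 r = x := by
      ext e
      by_cases h0 : x e = 0
      · simp only [glue]
        split_ifs <;> simp [r, h0]
      · have := hx e h0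
        rw [Set.mem_compl_iff, Set.mem_union, not_or] at this
        simp [glue, r, this.1, this.2]
    have hshift : ∀ (k l : Fin 2) (a : Config X) (b : Config Y) (c),
        W.psi k l (glue X Y a b (c + r))
          = zmodSign ((l : ℕ) : ZMod 2) * W.psi k l (glue X Y a b c) := by
      intro k l a b c
      have e : glue X Y a b (c + r) = glue X Y a b c + x := by
        conv_rhs => rw [← hglue]
        rw [← glue_add, add_zero, add_zero]
      rw [e, W.psi_add ⟨hxd, hz₁⟩, smul_dotProduct, hz₂, smul_eq_mul, mul_one]
    have hsign : zmodSign ((l : ℕ) : ZMod 2) * zmodSign ((l' : ℕ) : ZMod 2) = -1 := by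
      rw [← zmodSign_add, ← zmodSign_one]
      congr 1
      exact (by decide : ∀ l l' : Fin 2, l ≠ l' → ((l : ℕ) : ZMod 2) + ((l' : ℕ) : ZMod 2) = 1) l l' hl
    have key : ∑ c, W.psi k l (glue X Y a b c) * star (W.psi k' l' (glue X Y a' b' c))
        = -∑ c, W.psi k l (glue X Y a b c) * star (W.psi k' l' (glue X Y a' b' c)) := by
      conv_lhs => rw [← Equiv.sum_comp (Equiv.addRight r)]
      rw [← Finset.sum_neg_distrib]
      refine Finset.sum_congr rfl fun c _ => ?_
      rw [Equiv.coe_addRight, hshift, hshift, star_mul', star_zmodSign]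
      linear_combination (W.psi k l (glue X Y a b c) * star (W.psi k' l' (glue X Y a' b' c)))
        * hsign
    exact self_eq_neg.mp key
  -- For fluxes differing in `k`, a copy of `z₁` off both regions reads `k` from `c` alone, so the
  -- two factors are never both nonzero.
  · obtain ⟨z, hz, ht⟩ := W.exists_z₁_off hXY hX hY
    refine Finset.sum_eq_zero fun c _ => ?_
    rw [hN, hN]
    split_ifs with h1 h2
    · refine absurd (cast_fin_two_injective ?_) hk
      have e : ∀ s, M.IsDualLoop s → W.z₁ ⬝ᵥ s = z ⬝ᵥ s := fun s hs => by
        rw [← sub_eq_zero, ← sub_dotProduct]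
        exact hs.trivial_dotProduct ht
      rw [← h1.2, ← h2.2, e _ h1.1, e _ h2.1]
      exact dotProduct_glue_of_supportedOn hz _ _ _ _ _
    · rw [star_zero, mul_zero]
    · rw [zero_mul]
    · rw [zero_mul]

/-! ## Ground states -/

theorem hamiltonian_mulVec (M : TorusLattice D) (U J : ℝ) (φ : Config M.Edge → ℂ) :
    M.hamiltonian U J *ᵥ φ = -((U : ℂ) • ∑ s, M.starOp s *ᵥ φ)
      - (J : ℂ) • ∑ p, M.plaquetteOp p *ᵥ φ := by
  rw [hamiltonian, Matrix.sub_mulVec, Matrix.neg_mulVec, Matrix.smul_mulVec, Matrix.smul_mulVec,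
    Matrix.sum_mulVec, Matrix.sum_mulVec]

/-- The uniform superposition of the contractible dual loops is stabilized by all operators. -/
theorem exists_stabilized (M : TorusLattice D) : ∃ φ : Config M.Edge → ℂ, φ ≠ 0 ∧
    (∀ v, M.starOp v *ᵥ φ = φ) ∧ ∀ p, M.plaquetteOp p *ᵥ φ = φ := by
  refine ⟨fun s => if M.IsDualTrivial s then 1 else 0, fun h => ?_, fun v => ?_, fun p => ?_⟩
  · have := congrFun h 0
    simp only [Pi.zero_apply] at this
    rw [if_pos (show M.IsDualTrivial 0 from Submodule.zero_mem _)] at this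
    exact one_ne_zero this
  · ext s
    have hv : M.IsDualTrivial (M.legs v) := Submodule.subset_span ⟨v, rfl⟩
    have : M.IsDualTrivial (s + M.legs v) ↔ M.IsDualTrivial s :=
      Submodule.add_mem_iff_left _ hv
    rw [starOp, pauliX_mulVec]
    simp only [this]
  · ext s
    rw [plaquetteOp, pauliZ_mulVec]
    split_ifs with h
    · rw [h.isDualLoop p, zmodSign_zero, one_mul]
    · rw [mul_zero]

/-- The state of `exists_stabilized` bounds the lowest energy from above. Relative to this bound,
the energy of `ψ` exceeds it by half the weighted sum of the squared distances by which the terms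
move `ψ`, so all of these vanish. -/
theorem IsGroundState.stabilized {U J : ℝ} (hU : 0 < U) (hJ : 0 < J) {ψ : Config M.Edge → ℂ}
    (hψ : IsGroundState (M.hamiltonian U J) ψ) :
    (∀ v, M.starOp v *ᵥ ψ = ψ) ∧ ∀ p, M.plaquetteOp p *ᵥ ψ = ψ := by
  obtain ⟨hnorm, E₀, hE, hmin⟩ := hψ
  obtain ⟨φ, hφ, hA, hB⟩ := exists_stabilized M
  have hle : E₀ ≤ -(U * Fintype.card M.Vertex) - J * Fintype.card M.Face := by
    refine hmin _ φ hφ ?_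
    rw [hamiltonian_mulVec]
    simp only [hA, hB, Finset.sum_const, Finset.card_univ, ← Nat.cast_smul_eq_nsmul ℂ]
    ext s
    simp only [Pi.sub_apply, Pi.neg_apply, Pi.smul_apply, smul_eq_mul]
    push_cast
    ring
  have hre : ∀ χ, normSq χ = 1 → (star ψ ⬝ᵥ χ).re = 1 - normSq (ψ - χ) / 2 := fun χ hχ => by
    rw [normSq_sub, hnorm, hχ]
    ring
  have hAre : ∀ v, (star ψ ⬝ᵥ M.starOp v *ᵥ ψ).re = 1 - normSq (ψ - M.starOp v *ᵥ ψ) / 2 :=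
    fun v => hre _ (by rw [starOp, normSq_pauliX_mulVec, hnorm])
  have hBre : ∀ p, (star ψ ⬝ᵥ M.plaquetteOp p *ᵥ ψ).re
      = 1 - normSq (ψ - M.plaquetteOp p *ᵥ ψ) / 2 :=
    fun p => hre _ (by rw [plaquetteOp, normSq_pauliZ_mulVec, hnorm])
  have hval : E₀ = -(U * ∑ v, (1 - normSq (ψ - M.starOp v *ᵥ ψ) / 2))
      - J * ∑ p, (1 - normSq (ψ - M.plaquetteOp p *ᵥ ψ) / 2) := by
    have h := congrArg (fun χ => (star ψ ⬝ᵥ χ).re) hE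
    simp only [hamiltonian_mulVec, dotProduct_sub, dotProduct_neg, dotProduct_smul,
      dotProduct_sum, smul_eq_mul, ← normSq_eq_dotProduct, hnorm, Complex.ofReal_one, mul_one,
      Complex.ofReal_re, Complex.sub_re, Complex.neg_re, Complex.re_ofReal_mul,
      Complex.re_sum] at h
    rw [← h]
    simp only [hAre, hBre]
  have hSA : 0 ≤ ∑ v, normSq (ψ - M.starOp v *ᵥ ψ) := Finset.sum_nonneg fun _ _ => normSq_nonneg _
  have hSB : 0 ≤ ∑ p, normSq (ψ - M.plaquetteOp p *ᵥ ψ) :=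
    Finset.sum_nonneg fun _ _ => normSq_nonneg _
  simp only [Finset.sum_sub_distrib, Finset.sum_const, Finset.card_univ, nsmul_eq_mul, mul_one,
    ← Finset.sum_div] at hval
  have hUA := mul_nonneg hU.le hSA
  have hJB := mul_nonneg hJ.le hSB
  have hUA0 : U * ∑ v, normSq (ψ - M.starOp v *ᵥ ψ) = 0 := by linarith
  have hJB0 : J * ∑ p, normSq (ψ - M.plaquetteOp p *ᵥ ψ) = 0 := by linarith
  have hA0 := (mul_eq_zero.mp hUA0).resolve_left hU.ne'
  have hB0 := (mul_eq_zero.mp hJB0).resolve_left hJ.ne'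
  rw [Finset.sum_eq_zero_iff_of_nonneg fun _ _ => normSq_nonneg _] at hA0 hB0
  exact ⟨fun v => (sub_eq_zero.mp (normSq_eq_zero_iff.mp (hA0 v (Finset.mem_univ _)))).symm,
    fun p => (sub_eq_zero.mp (normSq_eq_zero_iff.mp (hB0 p (Finset.mem_univ _)))).symm⟩

/-- A stabilized state is a superposition of the states of definite flux. -/
theorem exists_eq_sum_psi {ψ : Config M.Edge → ℂ} (hA : ∀ v, M.starOp v *ᵥ ψ = ψ)
    (hB : ∀ p, M.plaquetteOp p *ᵥ ψ = ψ) :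
    ∃ c : Fin 2 → Fin 2 → ℂ, ψ = ∑ k, ∑ l, c k l • W.psi k l := by
  obtain ⟨N, hN0, hN⟩ := W.exists_psi_apply
  have hinv : ∀ u, M.IsDualTrivial u → ∀ s, ψ (s + u) = ψ s := by
    intro u hu
    induction hu using Submodule.span_induction with
    | mem u hu =>
      obtain ⟨v, rfl⟩ := hu
      intro s
      rw [← pauliX_mulVec (M.legs v) ψ]
      exact congrFun (hA v) s
    | zero => exact fun s => by rw [add_zero]
    | add a b _ _ ha hb => exact fun s => by rw [← add_assoc, hb, ha]
    | smul t a _ ha =>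
      intro s
      rcases ZMod.two_cases t with rfl | rfl
      · rw [zero_smul, add_zero]
      · rw [one_smul, ha]
  have hsupp : ∀ s, ¬ M.IsDualLoop s → ψ s = 0 := by
    intro s hs
    by_contra h0
    refine hs fun p => (ZMod.two_cases _).resolve_right fun h1 => h0 ?_
    have := congrFun (hB p) s
    rw [plaquetteOp, pauliZ_mulVec, h1, zmodSign_one] at this
    exact self_eq_neg.mp (by linear_combination -this)
  -- The value of `ψ` on a representative of each of the four homology classes.
  let g : ZMod 2 → ZMod 2 → ℂ := fun k m => ψ (k • W.x₂ + m • W.x₁)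
  have hg : ∀ s, M.IsDualLoop s → ψ s = g (W.z₁ ⬝ᵥ s) (W.z₂ ⬝ᵥ s) := by
    intro s hs
    set r := (W.z₁ ⬝ᵥ s) • W.x₂ + (W.z₂ ⬝ᵥ s) • W.x₁ with hr
    have ht : M.IsDualTrivial (s - r) := by
      refine W.isDualTrivial_of_dotProduct (hs.sub ((W.dual₂.smul _).add (W.dual₁.smul _))) ?_ ?_
      · simp [hr, dotProduct_sub, dotProduct_add, W.cross₁₁, W.cross₁₂]
      · simp [hr, dotProduct_sub, dotProduct_add, W.cross₂₁, W.cross₂₂]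
    have := hinv _ ht r
    rw [add_sub_cancel] at this
    exact this
  -- Fourier inversion over `ZMod 2` in the crossing parity with `z₂`; the factor `2 * N` combines
  -- the group order with the common amplitude.
  refine ⟨fun k l => (1 / (2 * N)) * (g ((k : ℕ) : ZMod 2) 0
    + zmodSign ((l : ℕ) : ZMod 2) * g ((k : ℕ) : ZMod 2) 1), ?_⟩
  ext s
  simp only [Fin.sum_univ_two, Pi.add_apply, Pi.smul_apply, smul_eq_mul, hN]
  by_cases hs : M.IsDualLoop s
  · rw [hg s hs]
    rcases ZMod.two_cases (W.z₁ ⬝ᵥ s) with h1 | h1 <;>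
      rcases ZMod.two_cases (W.z₂ ⬝ᵥ s) with h2 | h2 <;>
      simp [hs, h1, h2, zmodSign_zero, zmodSign_one] <;> field_simp <;> ring
  · simp [hs, hsupp s hs]

end FluxLoops

theorem RefinedPartition.apart {D : Type*} [Fintype D] {M : TorusLattice D}
    (P : RefinedPartition M) :
    FluxLoops.Apart M (P.part Region.A₁) (P.part Region.B₁) := fun d d' h =>
  h.elim (P.star_apart d d') (P.plaquette_apart d d')

end

theorem mainTheorem4 {D : Type*} [Fintype D] (M : TorusLattice D) (P : RefinedPartition M)
    (U J : ℝ) (hU : 0 < U) (hJ : 0 < J) (ψ : Config M.Edge → ℂ)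
    (hψ : IsGroundState (M.hamiltonian U J) ψ) :
    (∃ W : FluxLoops M, W.RunsAlong (P.part Region.A₁)) ∧
    (∀ W : FluxLoops M, (W.RunsAlong (P.part Region.A₁) ∨ W.RunsAlong (P.part Region.B₁)) →
      ∃ c : Fin 2 → Fin 2 → ℂ, ∑ k, ∑ l, ‖c k l‖ ^ 2 = 1 ∧
        ψ = ∑ k, ∑ l, c k l • W.psi k l ∧
        P.rhoA₁B₁ ψ = ∑ k, ∑ l, ((‖c k l‖ ^ 2 : ℝ) : ℂ) •
          (traceRight (P.rhoA₁B₁ (W.psi k l)) ⊗ₖ traceLeft (P.rhoA₁B₁ (W.psi k l)))) ∧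
    IsSeparableState (P.rhoA₁B₁ ψ) ∧
    logNegativity (P.rhoA₁B₁ ψ) = 0 := by
  have hdis := P.apart.disjoint
  obtain ⟨hA, hB⟩ := FluxLoops.IsGroundState.stabilized hU hJ hψ
  have hdens : ∀ (W : FluxLoops M) (k l : Fin 2), IsDensity (P.rhoA₁B₁ (W.psi k l)) :=
    fun W k l => ⟨posSemidef_reduced_densityMatrix _ _ _, by
      rw [RefinedPartition.rhoA₁B₁, trace_reduced_densityMatrix _ hdis, W.normSq_psi,
        Complex.ofReal_one]⟩
  have hmain : ∀ W : FluxLoops M,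
      (W.RunsAlong (P.part Region.A₁) ∨ W.RunsAlong (P.part Region.B₁)) →
      ∃ c : Fin 2 → Fin 2 → ℂ, ∑ k, ∑ l, ‖c k l‖ ^ 2 = 1 ∧
        ψ = ∑ k, ∑ l, c k l • W.psi k l ∧
        P.rhoA₁B₁ ψ = ∑ k, ∑ l, ((‖c k l‖ ^ 2 : ℝ) : ℂ) •
          (traceRight (P.rhoA₁B₁ (W.psi k l)) ⊗ₖ traceLeft (P.rhoA₁B₁ (W.psi k l))) := by
    intro W hW
    obtain ⟨hX, hY⟩ := FluxLoops.RunsAlong.onlyDirectionOne P.apart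
      (P.noncontractible Region.A₁) (P.noncontractible Region.B₁) hW
    obtain ⟨c, hc⟩ := W.exists_eq_sum_psi hA hB
    have hρ : P.rhoA₁B₁ ψ = ∑ k, ∑ l, ((‖c k l‖ ^ 2 : ℝ) : ℂ) •
        (traceRight (P.rhoA₁B₁ (W.psi k l)) ⊗ₖ traceLeft (P.rhoA₁B₁ (W.psi k l))) := by
      have h1 : ψ = ∑ i : Fin 2 × Fin 2, c i.1 i.2 • W.psi i.1 i.2 := by
        rw [Fintype.sum_prod_type]
        exact hc
      have h2 := reduced_densityMatrix_sum (P.part Region.A₁) (P.part Region.B₁)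
        (fun i : Fin 2 × Fin 2 => c i.1 i.2) (fun i => W.psi i.1 i.2) fun i j hij a a' b b' =>
          W.sum_psi_mul_star_psi P.apart hX hY hij a a' b b'
      rw [← h1, Fintype.sum_prod_type] at h2
      rw [RefinedPartition.rhoA₁B₁, h2]
      refine Finset.sum_congr rfl fun k _ => Finset.sum_congr rfl fun l _ => ?_
      exact congrArg _ (W.reduced_psi P.apart hX k l)
    refine ⟨c, ?_, hc, hρ⟩
    -- The weights sum to one by comparing traces in the decomposition, so orthonormality of the
    -- flux states is not needed separately.
    have htr := congrArg Matrix.trace hρ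
    simp only [Matrix.trace_sum, Matrix.trace_smul, Matrix.trace_kronecker,
      (hdens W _ _).traceRight.2, (hdens W _ _).traceLeft.2, mul_one, smul_eq_mul] at htr
    rw [RefinedPartition.rhoA₁B₁, trace_reduced_densityMatrix _ hdis, hψ.1] at htr
    exact_mod_cast htr.symm
  obtain ⟨W, hW⟩ := FluxLoops.exists_runsAlong (P.noncontractible Region.A₁)
  obtain ⟨c, hc, -, hρ⟩ := hmain W (Or.inl hW)
  have hsep : IsSeparableState (P.rhoA₁B₁ ψ) := by
    let e : Fin (2 * 2) ≃ Fin 2 × Fin 2 := finProdFinEquiv.symm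
    refine ⟨2 * 2, fun i => ‖c (e i).1 (e i).2‖ ^ 2,
      fun i => traceRight (P.rhoA₁B₁ (W.psi (e i).1 (e i).2)),
      fun i => traceLeft (P.rhoA₁B₁ (W.psi (e i).1 (e i).2)), fun i => by positivity, ?_,
      fun i => (hdens W _ _).traceRight, fun i => (hdens W _ _).traceLeft, ?_⟩
    · rw [← hc, e.sum_comp fun i => ‖c i.1 i.2‖ ^ 2, Fintype.sum_prod_type]
    · rw [hρ, e.sum_comp fun i => ((‖c i.1 i.2‖ ^ 2 : ℝ) : ℂ) •
        (traceRight (P.rhoA₁B₁ (W.psi i.1 i.2)) ⊗ₖ traceLeft (P.rhoA₁B₁ (W.psi i.1 i.2))),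
        Fintype.sum_prod_type]
  exact ⟨⟨W, hW⟩, hmain, hsep, hsep.logNegativity_eq_zero⟩
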